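/- A Jacobi matrix is a real symmetric tridiagonal matrix with negative off-diagonal entries; its diagonal entries are $a_0,\dots,a_{N-1}$ and its off-diagonal entries are $b_0,\dots,b_{N-2}<0$. Let $\sigma=\{\lambda_1<\dots<\lambda_N\}$ and $\hat\sigma=\{\hat\lambda_1<\dots<\hat\lambda_N\}$ be sets of $N\ge 1$ real numbers, $K\in\mathbb R$ and $n\in\{0,\dots,N-1\}$. Put $$\{\mu_1,\dots,\mu_q\}:=(\sigma\cap\hat\sigma)\setminus\{K\}\ (q\ge 0),\qquad \tilde n:=\min(n,N-n-1),\qquad \hat N(\lambda):=\frac{\prod_{j=1}^N(\lambda-\hat\lambda_j)}{\prod_{j=1}^N(\lambda-\lambda_j)},$$ where $\hat N$ is extended continuously to $\sigma\cap\hat\sigma$. Let $\theta>0$, with $\theta^2=\hat N(\mu_1)$ if $q>0$, and with $\theta^2$ a fixed number in $(0,\hat N(K)]$ if $q=0$. Assume: (I) If $p\in\{0,\dots,N\}$ is the number of $j$ with $\lambda_j<K$, then exactly one point of $\hat\sigma$ lies in each of the intervals $[\lambda_j,\lambda_{j+1})$ for $1\le j\le p-1$, $(\lambda_j,\lambda_{j+1}]$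 for $p+1\le j\le N-1$, $[\lambda_p,K)$ if $p\ge 1$, and $(K,\lambda_{p+1}]$ if $p<N$ and $K<\lambda_{p+1}$. (II) $\theta^2=\hat N(\mu_1)=\dots=\hat N(\mu_q)$ and $\theta^2\in(0,1)$. (III) If $K\notin\sigma\cup\hat\sigma$, then $q\le\tilde n$ and $\hat N(K)=\theta^2$. (IV) If $K\in\sigma\cup\hat\sigma$, then $K\in\sigma\cap\hat\sigma$ and either a) $q\le\tilde n$ and $\hat N(K)>\theta^2$, or b) $q<\tilde n$, $\hat N(K)=\theta^2$ and $\hat N'(K)=0$. Let $S$ be the set of all pairs $(J,\tilde J)$ of $N\times N$ Jacobi matrices such that $J$ has spectrum $\sigma$, $\tilde J$ has spectrum $\hat\sigma$, and $\tilde J$ is obtained from $J$ by $\tilde a_n=\theta^2(a_n+M)$, $\tilde b_{n-1}=\theta b_{n-1}$, $\tilde b_n=\theta b_n$ with $M=(\theta^{-2}-1)K$ (when $n=0$ or $n=N-1$ the undefined entry is omitted), all other entries being the same. 1. If $K\notin\sigma\cup\hat\sigma$, or if $K\in\sigma\cup\hat\sigma$ and IV a) holds, then $S$ is the union of exactly $\binom{N-2q-1}{n-q}$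 pairwise disjoint smooth embedded submanifolds of dimension $q$, each relatively open in $S$ and diffeomorphic to the open ball of $\mathbb R^q$. If $q\ne 0$, then $S$ is infinite; if $q=0$, then $S$ is finite with exactly $\binom{N-1}{n}$ elements. 2. If $K\in\sigma\cup\hat\sigma$ and IV b) holds, then $S$ is infinite and is the union of exactly $\binom{N-2q-3}{n-q-1}$ pairwise disjoint smooth embedded submanifolds of dimension $q+1$, each relatively open in $S$ and diffeomorphic to the open ball of $\mathbb R^{q+1}$. -/

import Mathlib

open scoped ContDiff Matrix.Norms.Elementwise

noncomputable section

/-- Real `N × N` Jacobi matrices: symmetric, tridiagonal, with negative off-diagonal entries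
(the sign coming from `b_i = -γ_{i+1} / √(m_i m_{i+1})`). -/
structure IsJacobi {N : ℕ} (J : Matrix (Fin N) (Fin N) ℝ) : Prop where
  symm : J.IsSymm
  eq_zero : ∀ i j : Fin N, i.val + 1 < j.val → J i j = 0
  neg : ∀ i j : Fin N, i.val + 1 = j.val → J i j < 0

/-- The perturbation of `J` at place `n`: the entry `a_n` becomes `θ² (a_n + M)` with
`M = (θ⁻² - 1) K`, the other entries of row `n` and column `n` (for a Jacobi matrix only
`b_{n-1}` and `b_n` are nonzero) are multiplied by `θ`, and the rest is unchanged. -/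
def perturb {N : ℕ} (n : Fin N) (θ K : ℝ) (J : Matrix (Fin N) (Fin N) ℝ) :
    Matrix (Fin N) (Fin N) ℝ :=
  Matrix.of fun i j =>
    if i = n ∧ j = n then θ ^ 2 * (J n n + ((θ ^ 2)⁻¹ - 1) * K)
    else if i = n ∨ j = n then θ * J i j
    else J i j

/-- The set of values `{lam 0, …, lam (N-1)}`. -/
def pts {N : ℕ} (lam : Fin N → ℝ) : Finset ℝ := Finset.univ.image lam

/-- The common points `{μ_1, …, μ_q} = (σ ∩ σ̂) \ {K}`. -/
def commonPts {N : ℕ} (lam lamh : Fin N → ℝ) (K : ℝ) : Finset ℝ :=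
  (pts lam ∩ pts lamh).erase K

/-- The rational function `∏ (x - λ̂_j) / ∏ (x - λ_j)` with common factors cancelled, so that
it takes its limit value at the points of `σ ∩ σ̂`. -/
def Nhat {N : ℕ} (lam lamh : Fin N → ℝ) (x : ℝ) : ℝ :=
  (∏ y ∈ pts lamh \ pts lam, (x - y)) / ∏ y ∈ pts lam \ pts lamh, (x - y)

/-- Away from `σ`, `Nhat` is the literal quotient. -/
theorem Nhat_eq_div {N : ℕ} {lam lamh : Fin N → ℝ} (hl : StrictMono lam)
    (hlh : StrictMono lamh) {x : ℝ} (hx : x ∉ pts lam) :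
    Nhat lam lamh x = (∏ j, (x - lamh j)) / ∏ j, (x - lam j) := by
  have e1 : ∏ j, (x - lam j) = ∏ y ∈ pts lam, (x - y) := by
    rw [pts, Finset.prod_image (fun a _ b _ h => hl.injective h)]
  have e2 : ∏ j, (x - lamh j) = ∏ y ∈ pts lamh, (x - y) := by
    rw [pts, Finset.prod_image (fun a _ b _ h => hlh.injective h)]
  have h1 := Finset.prod_inter_mul_prod_sdiff (pts lam) (pts lamh) (fun y => x - y)
  have h2 := Finset.prod_inter_mul_prod_sdiff (pts lamh) (pts lam) (fun y => x - y)
  have h0 : ∏ y ∈ pts lam ∩ pts lamh, (x - y) ≠ 0 := by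
    refine Finset.prod_ne_zero_iff.2 fun y hy h => hx ?_
    rw [sub_eq_zero.1 h]
    exact (Finset.mem_inter.1 hy).1
  rw [e1, e2, ← h1, ← h2, Finset.inter_comm (pts lamh) (pts lam), Nhat,
    mul_div_mul_left _ _ h0]

/-- `Nhat` is continuous at every point that is not in `σ \ σ̂`, in particular on `σ ∩ σ̂`. -/
theorem Nhat_continuousAt {N : ℕ} {lam lamh : Fin N → ℝ} {x : ℝ}
    (hx : x ∉ pts lam \ pts lamh) : ContinuousAt (Nhat lam lamh) x := by
  unfold Nhat
  refine ContinuousAt.div (by fun_prop) (by fun_prop) ?_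
  refine Finset.prod_ne_zero_iff.2 fun y hy h => hx ?_
  rw [sub_eq_zero.1 h]
  exact hy

/-- Interlacing of `σ`, `σ̂` and `K`. With indices starting at `0`, `p` is the number of points
of `σ` below `K`; then exactly one point of `σ̂` lies in each of the intervals
`[λ_i, λ_{i+1})` with `i + 1 < p`, `(λ_i, λ_{i+1}]` with `p ≤ i`, in `[λ_{p-1}, K)` (if `p ≥ 1`)
and in `(K, λ_p]` (if `p < N` and this interval is not empty). -/
def Interlace {N : ℕ} (lam lamh : Fin N → ℝ) (K : ℝ) : Prop :=
  ∃ p : ℕ, p ≤ N ∧ (∀ i : Fin N, lam i < K ↔ i.val < p) ∧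
    (∀ i j : Fin N, i.val + 1 = j.val → j.val < p →
      ∃! k : Fin N, lamh k ∈ Set.Ico (lam i) (lam j)) ∧
    (∀ i j : Fin N, i.val + 1 = j.val → p ≤ i.val →
      ∃! k : Fin N, lamh k ∈ Set.Ioc (lam i) (lam j)) ∧
    (∀ i : Fin N, i.val + 1 = p → ∃! k : Fin N, lamh k ∈ Set.Ico (lam i) K) ∧
    (∀ i : Fin N, i.val = p → K < lam i → ∃! k : Fin N, lamh k ∈ Set.Ioc K (lam i))

/-- First alternative for `K ∈ σ ∪ σ̂`: `q ≤ min (n, N - n - 1)` and `N̂(K) > θ²`. -/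
def CaseA {N : ℕ} (n : Fin N) (lam lamh : Fin N → ℝ) (K θ : ℝ) : Prop :=
  (commonPts lam lamh K).card ≤ min n.val (N - n.val - 1) ∧ θ ^ 2 < Nhat lam lamh K

/-- Second alternative for `K ∈ σ ∪ σ̂`: `q < min (n, N - n - 1)`, `N̂(K) = θ²` and `N̂'(K) = 0`. -/
def CaseB {N : ℕ} (n : Fin N) (lam lamh : Fin N → ℝ) (K θ : ℝ) : Prop :=
  (commonPts lam lamh K).card < min n.val (N - n.val - 1) ∧ Nhat lam lamh K = θ ^ 2 ∧
    deriv (Nhat lam lamh) K = 0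

/-- The necessary and sufficient conditions on the spectral data, together with the choice of `θ²`: it is the
common value of `N̂` at the points `μ_1, …, μ_q` if `q > 0`, and a fixed number in
`(0, N̂(K)]` if `q = 0`. -/
structure SpectralConditions {N : ℕ} (n : Fin N) (lam lamh : Fin N → ℝ) (K θ : ℝ) : Prop where
  theta_pos : 0 < θ
  theta_choice : commonPts lam lamh K = ∅ → θ ^ 2 ≤ Nhat lam lamh K
  interlace : Interlace lam lamh K
  cond_common : (∀ μ ∈ commonPts lam lamh K, Nhat lam lamh μ = θ ^ 2) ∧ θ ^ 2 < 1
  cond_notMem : K ∉ pts lam ∪ pts lamh →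
    (commonPts lam lamh K).card ≤ min n.val (N - n.val - 1) ∧ Nhat lam lamh K = θ ^ 2
  cond_mem : K ∈ pts lam ∪ pts lamh → K ∈ pts lam ∩ pts lamh ∧
    (CaseA n lam lamh K θ ∨ CaseB n lam lamh K θ)

/-- The inverse spectral family: all pairs `(J, J̃)` of Jacobi matrices such that `J̃` is the
perturbation of `J` at place `n`, `J` has spectrum `σ` and `J̃` has spectrum `σ̂`. -/
def inverseFamily {N : ℕ} (n : Fin N) (lam lamh : Fin N → ℝ) (K θ : ℝ) :
    Set (Matrix (Fin N) (Fin N) ℝ × Matrix (Fin N) (Fin N) ℝ) :=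
  {P | IsJacobi P.1 ∧ IsJacobi P.2 ∧ P.2 = perturb n θ K P.1 ∧
    spectrum ℝ P.1 = Set.range lam ∧ spectrum ℝ P.2 = Set.range lamh}

/-- The subset `X` of a normed space is a smooth embedded `d`-dimensional submanifold
diffeomorphic to the open unit ball of `ℝ^d`: there are mutually inverse maps between the ball
and `X`, the first one smooth, the second one the restriction of a smooth map defined on an
open neighbourhood of `X`. -/
def IsBallManifold (d : ℕ) {E : Type*} [NormedAddCommGroup E] [NormedSpace ℝ E]
    (X : Set E) : Prop :=
  ∃ (φ : EuclideanSpace ℝ (Fin d) → E) (ψ : E → EuclideanSpace ℝ (Fin d)) (U : Set E),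
    ContDiffOn ℝ ∞ φ (Metric.ball 0 1) ∧ IsOpen U ∧ X ⊆ U ∧ ContDiffOn ℝ ∞ ψ U ∧
    Set.MapsTo φ (Metric.ball 0 1) X ∧ Set.MapsTo ψ X (Metric.ball 0 1) ∧
    Set.InvOn ψ φ (Metric.ball 0 1) X

/-- `S` is the union of `c` pairwise disjoint `d`-dimensional manifolds, each relatively open in
`S` (so that they are the connected components of `S`) and diffeomorphic to an open ball. -/
def IsDisjointUnionOfBalls (c d : ℕ) {E : Type*} [NormedAddCommGroup E] [NormedSpace ℝ E]
    (S : Set E) : Prop :=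
  ∃ X : Fin c → Set E, Pairwise (fun i j => Disjoint (X i) (X j)) ∧ (⋃ i, X i) = S ∧
    ∀ i, (∃ U : Set E, IsOpen U ∧ X i = S ∩ U) ∧ IsBallManifold d (X i)

end

/-!
Write `χ` and `χ̃` for the characteristic polynomials of `J` and of its perturbation at the site
`n`, and `P` for that of `J` with row and column `n` removed. Expanding along the site `n` gives
`χ̃ = θ² χ + (1 - θ²) (x - K) P` (`IsJacobi.charpoly_perturb`), so the two spectra prescribe `χ` and
`P`, that is, the entry `(n, n)` of the resolvent of `J`. The matrix `J` splits at `n` into two half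
lines going outward, with characteristic polynomials `D_L`, `D_R`; let `B_L / D_L`, `B_R / D_R` be
their resolvent entries at the sites adjacent to `n` times the squared couplings to `n`. Then
`χ = (x - a_n) D_L D_R - B_L D_R - D_L B_R`, `P = D_L D_R` (`IsJacobi.charpoly_eq`). Hence
`χ / P = x - a_n - B_L / D_L - B_R / D_R`.

Let `W` be the set of common zeros of `P` and `χ`: the points `μ_1, …, μ_q`, together with `K` if
`K ∈ σ`, `N̂(K) = θ²` and `N̂'(K) = 0`. Interlacing (`interlace_sign`) and, if `K ∈ σ`, the condition
`N̂(K) ≥ θ²` make all residues of `P / χ` nonnegative, those outside `W` positive. After cancelling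
the factors that belong to `W`, one step of the Euclidean algorithm (`PosPair.step`) turns `χ / P`
into `x - a - ∑ η_z / (x - z)`, summed over a finite real set `Z ⊇ W`, with all `η_z > 0`. The zeros
of `P` are the points of `Z`; those in `W` are double, the others simple. The half lines have simple
real spectrum and positive residues (`exists_posPair`), so a solution amounts to the following
choice (`split_iff`): a set `A` of `n - |W|` points of `Z \ W`, which are poles of the left half
line, while the rest of `Z \ W` consists of poles of the right one, and for every `z ∈ W`, a pole of
both, a splitting of `η_z` into two positive parts. Given these, each half line exists, is unique,
and depends smoothly on the residues by the Euclidean algorithm (`exists_smooth_halfLine`,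
`halfLine_unique`). Every `A` thus contributes an open cube of dimension `|W|`, and there are
`(N - 2|W| - 1).choose (n - |W|)` sets `A`.
-/

noncomputable section

namespace JacobiInverse

open Polynomial

/-! ### Products of linear factors and positive pairs -/

/-- The monic real polynomial whose roots are the points of `Z`, all of them simple. -/
def nod (Z : Finset ℝ) : ℝ[X] := ∏ z ∈ Z, (X - C z)

theorem nod_monic (Z : Finset ℝ) : (nod Z).Monic :=
  monic_prod_of_monic _ _ fun z _ => monic_X_sub_C z

theorem nod_ne_zero (Z : Finset ℝ) : nod Z ≠ 0 := (nod_monic Z).ne_zero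

theorem degree_nod (Z : Finset ℝ) : (nod Z).degree = Z.card := by
  simp [nod, degree_prod]

theorem natDegree_nod (Z : Finset ℝ) : (nod Z).natDegree = Z.card :=
  natDegree_eq_of_degree_eq_some (degree_nod Z)

theorem eval_nod (Z : Finset ℝ) (x : ℝ) : (nod Z).eval x = ∏ z ∈ Z, (x - z) := by
  simp [nod, eval_prod]

theorem eval_nod_eq_zero {Z : Finset ℝ} {x : ℝ} : (nod Z).eval x = 0 ↔ x ∈ Z := by
  rw [eval_nod, Finset.prod_eq_zero_iff]
  constructor
  · rintro ⟨z, hz, h⟩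
    rwa [sub_eq_zero.1 h]
  · exact fun h => ⟨x, h, sub_self x⟩

theorem roots_nod (Z : Finset ℝ) : (nod Z).roots = Z.val := roots_prod_X_sub_C Z

theorem nod_injective : Function.Injective nod := fun Y Z h =>
  Finset.val_injective (by rw [← roots_nod, ← roots_nod, h])

theorem nod_union {Y Z : Finset ℝ} (h : Disjoint Y Z) : nod (Y ∪ Z) = nod Y * nod Z :=
  Finset.prod_union h

theorem nod_insert {Z : Finset ℝ} {z : ℝ} (hz : z ∉ Z) :
    nod (insert z Z) = (X - C z) * nod Z := Finset.prod_insert hz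

theorem nod_erase {Z : Finset ℝ} {z : ℝ} (hz : z ∈ Z) :
    nod Z = (X - C z) * nod (Z.erase z) := (Finset.mul_prod_erase Z _ hz).symm

theorem eval_derivative_nod {Z : Finset ℝ} {z : ℝ} (hz : z ∈ Z) :
    (derivative (nod Z)).eval z = (nod (Z.erase z)).eval z := by
  rw [nod_erase hz]
  simp

theorem eval_nod_erase_self_ne_zero (Z : Finset ℝ) (z : ℝ) : (nod (Z.erase z)).eval z ≠ 0 := by
  simp [eval_nod_eq_zero]

theorem eval_nod_erase_of_ne {Z : Finset ℝ} {y z : ℝ} (hy : y ∈ Z) (h : y ≠ z) :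
    (nod (Z.erase z)).eval y = 0 := by
  simp [eval_nod_eq_zero, hy, h]

/-- The polynomial whose quotient by `nod Z` has the partial fraction expansion
`∑ w z / (X - z)`. -/
def residuePoly (Z : Finset ℝ) (w : ℝ → ℝ) : ℝ[X] := ∑ z ∈ Z, C (w z) * nod (Z.erase z)

theorem degree_residuePoly_lt (Z : Finset ℝ) (w : ℝ → ℝ) :
    (residuePoly Z w).degree < Z.card := by
  refine (degree_sum_le _ _).trans_lt ?_
  refine (Finset.sup_lt_iff (WithBot.bot_lt_coe _)).2 fun z hz => ?_
  rw [← smul_eq_C_mul]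
  refine (degree_smul_le _ _).trans_lt ?_
  rw [degree_nod]
  exact_mod_cast Finset.card_erase_lt_of_mem hz

theorem eval_residuePoly {Z : Finset ℝ} (w : ℝ → ℝ) {z : ℝ} (hz : z ∈ Z) :
    (residuePoly Z w).eval z = w z * (nod (Z.erase z)).eval z := by
  rw [residuePoly, eval_finsetSum, Finset.sum_eq_single_of_mem z hz]
  · simp
  · intro y _ hne
    simp [eval_nod_erase_of_ne hz hne.symm]

/-- Lagrange interpolation in the form of a partial fraction expansion. -/
theorem eq_residuePoly {Z : Finset ℝ} {B : ℝ[X]} (hB : B.degree < Z.card) {w : ℝ → ℝ}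
    (hw : ∀ z ∈ Z, B.eval z = w z * (nod (Z.erase z)).eval z) : B = residuePoly Z w :=
  eq_of_degrees_lt_of_eval_finset_eq Z hB (degree_residuePoly_lt Z w) fun z hz => by
    rw [hw z hz, eval_residuePoly w hz]

theorem residuePoly_congr {Z : Finset ℝ} {v w : ℝ → ℝ} (h : ∀ z ∈ Z, v z = w z) :
    residuePoly Z v = residuePoly Z w :=
  Finset.sum_congr rfl fun z hz => by rw [h z hz]

/-- The rational function `B / nod Z` is a sum `∑ w z / (X - z)` over `z ∈ Z` with all weights
`w z` positive. -/
def PosPair (Z : Finset ℝ) (B : ℝ[X]) : Prop :=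
  B.degree < Z.card ∧ ∀ z ∈ Z, 0 < B.eval z * (nod (Z.erase z)).eval z

/-- The residue of `B / nod Z` at `z`. -/
def residue (Z : Finset ℝ) (B : ℝ[X]) (z : ℝ) : ℝ := B.eval z / (nod (Z.erase z)).eval z

theorem PosPair.residue_pos {Z : Finset ℝ} {B : ℝ[X]} (h : PosPair Z B) {z : ℝ} (hz : z ∈ Z) :
    0 < residue Z B z := by
  have := h.2 z hz
  rw [residue, div_eq_mul_inv]
  rcases pos_and_pos_or_neg_and_neg_of_mul_pos this with h | h
  · exact mul_pos h.1 (inv_pos.2 h.2)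
  · exact mul_pos_of_neg_of_neg h.1 (inv_lt_zero.2 h.2)

theorem eq_residuePoly_residue {Z : Finset ℝ} {B : ℝ[X]} (hB : B.degree < Z.card) :
    B = residuePoly Z (residue Z B) :=
  eq_residuePoly hB fun z _ => (div_mul_cancel₀ _ (eval_nod_erase_self_ne_zero Z z)).symm

theorem posPair_residuePoly {Z : Finset ℝ} {w : ℝ → ℝ} (hw : ∀ z ∈ Z, 0 < w z) :
    PosPair Z (residuePoly Z w) := by
  refine ⟨degree_residuePoly_lt Z w, fun z hz => ?_⟩
  rw [eval_residuePoly w hz, mul_assoc]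
  exact mul_pos (hw z hz) (mul_self_pos.2 (eval_nod_erase_self_ne_zero Z z))

theorem coeff_residuePoly {Z : Finset ℝ} {m : ℕ} (hZ : Z.card = m + 1) (w : ℝ → ℝ) :
    (residuePoly Z w).coeff m = ∑ z ∈ Z, w z := by
  rw [residuePoly, finsetSum_coeff]
  refine Finset.sum_congr rfl fun z hz => ?_
  have h : (nod (Z.erase z)).natDegree = m := by
    rw [natDegree_nod, Finset.card_erase_of_mem hz, hZ, Nat.add_sub_cancel]
  have := (nod_monic (Z.erase z)).coeff_natDegree
  rw [h] at this
  rw [coeff_C_mul, this, mul_one]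

theorem PosPair.coeff_pos {Z : Finset ℝ} {B : ℝ[X]} {m : ℕ} (h : PosPair Z B)
    (hZ : Z.card = m + 1) : 0 < B.coeff m := by
  rw [eq_residuePoly_residue h.1, coeff_residuePoly hZ]
  exact Finset.sum_pos (fun z hz => h.residue_pos hz) (Finset.card_pos.1 (by omega))

/-- At a zero of `B` the derivative of `B / nod Z = ∑ w z / (X - z)` is negative. -/
theorem PosPair.derivative_mul_neg {Z : Finset ℝ} {B : ℝ[X]} (h : PosPair Z B)
    (hZ : Z.Nonempty) {x : ℝ} (hx : B.eval x = 0) :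
    (derivative B).eval x * (nod Z).eval x < 0 := by
  have hxZ : x ∉ Z := fun hxZ => by simpa [hx] using h.2 x hxZ
  have key : derivative B * nod Z - B * derivative (nod Z) =
      - ∑ z ∈ Z, C (residue Z B z) * nod (Z.erase z) ^ 2 := by
    conv_lhs => rw [eq_residuePoly_residue h.1]
    rw [residuePoly, derivative_sum, Finset.sum_mul, Finset.sum_mul, ← Finset.sum_sub_distrib,
      ← Finset.sum_neg_distrib]
    refine Finset.sum_congr rfl fun z hz => ?_
    rw [nod_erase hz, derivative_mul, derivative_mul, derivative_C, derivative_X_sub_C]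
    ring
  have h2 := congrArg (eval x) key
  simp only [eval_sub, eval_mul, hx, zero_mul, sub_zero, eval_neg, eval_finsetSum, eval_C,
    eval_pow] at h2
  rw [h2, neg_lt_zero]
  refine Finset.sum_pos (fun z hz => mul_pos (h.residue_pos hz) (sq_pos_of_ne_zero ?_)) hZ
  exact fun h0 => hxZ (Finset.mem_of_mem_erase (eval_nod_eq_zero.1 h0))

/-- `B / nod Z` passes from `+∞` to `-∞` between consecutive points of `Z`. -/
theorem PosPair.exists_root_between {Z : Finset ℝ} {B : ℝ[X]} (h : PosPair Z B) {y z : ℝ}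
    (hy : y ∈ Z) (hz : z ∈ Z) (hyz : y < z) (hgap : ∀ x ∈ Z, x ≤ y ∨ z ≤ x) :
    ∃ x, y < x ∧ x < z ∧ B.eval x = 0 := by
  have hpos : 0 < (nod ((Z.erase y).erase z)).eval y * (nod ((Z.erase y).erase z)).eval z := by
    rw [eval_nod, eval_nod, ← Finset.prod_mul_distrib]
    refine Finset.prod_pos fun x hx => ?_
    simp only [Finset.mem_erase] at hx
    rcases hgap x hx.2.2 with h1 | h1
    · have : x < y := lt_of_le_of_ne h1 hx.2.1
      exact mul_pos (by linarith) (by linarith)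
    · have : z < x := lt_of_le_of_ne h1 (Ne.symm hx.1)
      exact mul_pos_of_neg_of_neg (by linarith) (by linarith)
  have h1 := h.2 y hy
  have h2 := h.2 z hz
  rw [nod_erase (Finset.mem_erase.2 ⟨hyz.ne', hz⟩), eval_mul] at h1
  rw [nod_erase (Finset.mem_erase.2 ⟨hyz.ne, hy⟩), eval_mul, Finset.erase_right_comm] at h2
  simp only [eval_sub, eval_X, eval_C] at h1 h2
  have h3 : B.eval y * B.eval z < 0 := by
    have h4 := mul_pos h1 h2
    have h5 : 0 < (z - y) ^ 2 * ((nod ((Z.erase y).erase z)).eval y *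
      (nod ((Z.erase y).erase z)).eval z) := mul_pos (pow_pos (sub_pos.2 hyz) 2) hpos
    by_contra h6
    have := mul_nonneg (not_lt.1 h6) h5.le
    nlinarith
  have hcont : ContinuousOn (fun x => B.eval x) (Set.Icc y z) := B.continuous.continuousOn
  rcases mul_neg_iff.1 h3 with ⟨h4, h5⟩ | ⟨h4, h5⟩
  · obtain ⟨x, hx, hx0⟩ := intermediate_value_Ioo' hyz.le hcont ⟨h5, h4⟩
    exact ⟨x, hx.1, hx.2, hx0⟩
  · obtain ⟨x, hx, hx0⟩ := intermediate_value_Ioo hyz.le hcont ⟨h4, h5⟩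
    exact ⟨x, hx.1, hx.2, hx0⟩

/-- The numerator of a sum of simple fractions with positive weights is real rooted, with simple
roots. -/
theorem PosPair.exists_eq_nod {Z : Finset ℝ} {B : ℝ[X]} {m : ℕ} (h : PosPair Z B)
    (hZ : Z.card = m + 1) :
    ∃ Y : Finset ℝ, Y.card = m ∧ B = C (B.coeff m) * nod Y := by
  let e := Z.orderEmbOfFin hZ
  have hroot : ∀ i : Fin m, ∃ x, e i.castSucc < x ∧ x < e i.succ ∧ B.eval x = 0 := by
    intro i
    refine h.exists_root_between (Z.orderEmbOfFin_mem hZ _) (Z.orderEmbOfFin_mem hZ _)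
      (e.strictMono i.castSucc_lt_succ) fun x hx => ?_
    rw [← Finset.mem_coe, ← Z.range_orderEmbOfFin hZ] at hx
    obtain ⟨j, rfl⟩ := hx
    rcases lt_or_ge i.castSucc j with hij | hij
    · exact Or.inr (e.monotone (Fin.castSucc_lt_iff_succ_le.1 hij))
    · exact Or.inl (e.monotone hij)
  choose x hx1 hx2 hx3 using hroot
  have hx : StrictMono x := fun i j hij => (hx2 i).trans <|
    lt_of_le_of_lt (e.monotone (Fin.succ_le_castSucc_iff.2 hij)) (hx1 j)
  have hcard : (Finset.univ.image x).card = m := by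
    rw [Finset.card_image_of_injective _ hx.injective, Finset.card_univ, Fintype.card_fin]
  refine ⟨Finset.univ.image x, hcard, ?_⟩
  refine eq_of_degree_sub_lt_of_eval_finset_eq (Finset.univ.image x) ?_ ?_
  · rw [hcard, degree_lt_iff_coeff_zero]
    intro k hk
    have hmon := (nod_monic (Finset.univ.image x)).coeff_natDegree
    rw [natDegree_nod, hcard] at hmon
    rcases hk.eq_or_lt with rfl | hk
    · simp [hmon]
    · have h1 : B.coeff k = 0 := coeff_eq_zero_of_degree_lt <| h.1.trans_le <| by
        rw [hZ]; exact_mod_cast hk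
      have h2 : (nod (Finset.univ.image x)).coeff k = 0 := coeff_eq_zero_of_degree_lt <| by
        rw [degree_nod, hcard]; exact_mod_cast hk
      simp [h1, h2]
  · intro y hy
    obtain ⟨i, -, rfl⟩ := Finset.mem_image.1 hy
    rw [hx3 i, eval_mul, eval_nod_eq_zero.2 hy, mul_zero]

/-- One step of the Euclidean algorithm preserves positive pairs. Writing the coefficient of the
linear factor as a coefficient of `X * nod Y` avoids a case distinction for `m = 0`. -/
theorem PosPair.step {Z : Finset ℝ} {B : ℝ[X]} {m : ℕ} (h : PosPair Z B)
    (hZ : Z.card = m + 1) :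
    ∃ Y : Finset ℝ, Y.card = m ∧ B = C (B.coeff m) * nod Y ∧
      PosPair Y ((X - C ((X * nod Y).coeff m - (nod Z).coeff m)) * nod Y - nod Z) := by
  obtain ⟨Y, hY, hB⟩ := h.exists_eq_nod hZ
  have hc := h.coeff_pos hZ
  set a := (X * nod Y).coeff m - (nod Z).coeff m
  have hYm : (nod Y).coeff m = 1 := by
    have := (nod_monic Y).coeff_natDegree
    rwa [natDegree_nod, hY] at this
  have hZm : (nod Z).coeff (m + 1) = 1 := by
    have := (nod_monic Z).coeff_natDegree
    rwa [natDegree_nod, hZ] at this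
  refine ⟨Y, hY, hB, ?_, fun y hy => ?_⟩
  · rw [hY, degree_lt_iff_coeff_zero]
    intro k hk
    rw [sub_mul, coeff_sub, coeff_sub, coeff_C_mul]
    rcases hk.eq_or_lt with rfl | hk
    · rw [hYm]; ring
    · have h2 : (nod Y).coeff k = 0 := coeff_eq_zero_of_degree_lt <| by
        rw [degree_nod, hY]; exact_mod_cast hk
      obtain ⟨k, rfl⟩ : ∃ l, k = l + 1 := ⟨k - 1, by omega⟩
      rw [h2, coeff_X_mul]
      rcases (Nat.lt_succ_iff.1 hk).eq_or_lt with rfl | hk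
      · rw [hYm, hZm]; ring
      · have h3 : (nod Y).coeff k = 0 := coeff_eq_zero_of_degree_lt <| by
          rw [degree_nod, hY]; exact_mod_cast hk
        have h4 : (nod Z).coeff (k + 1) = 0 := coeff_eq_zero_of_degree_lt <| by
          rw [degree_nod, hZ]; exact_mod_cast Nat.succ_lt_succ hk
        rw [h3, h4]; ring
  · have hy0 : B.eval y = 0 := by rw [hB, eval_mul, eval_nod_eq_zero.2 hy, mul_zero]
    have h1 := h.derivative_mul_neg (Finset.card_pos.1 (by omega)) hy0
    have h2 : (derivative B).eval y = B.coeff m * (nod (Y.erase y)).eval y := by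
      conv_lhs => rw [hB]
      rw [derivative_C_mul, eval_mul, eval_C, eval_derivative_nod hy]
    rw [h2, mul_assoc] at h1
    have h3 := (pos_iff_neg_of_mul_neg h1).1 hc
    rw [eval_sub, eval_mul, eval_nod_eq_zero.2 hy]
    linarith

/-! ### Half-line polynomials of a Jacobi matrix -/

/-- The characteristic polynomial of the Jacobi matrix of size `m` with diagonal
`α 0, …, α (m - 1)` and off-diagonal `β 1, …, β (m - 1)`. The entry `β 0` couples this block to
the rest of a larger matrix; it does not enter here. -/
def denPoly (α β : ℕ → ℝ) : ℕ → ℝ[X]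
  | 0 => 1
  | 1 => X - C (α 0)
  | k + 2 => (X - C (α (k + 1))) * denPoly α β (k + 1) - C (β (k + 1) ^ 2) * denPoly α β k

/-- `β 0 ^ 2` times the characteristic polynomial of the block with its first row and column
removed (zero for the empty block), so that `numPoly / denPoly` is `β 0 ^ 2` times the first
diagonal entry of the inverse of `x - T`, where `T` is the block. -/
def numPoly (α β : ℕ → ℝ) : ℕ → ℝ[X]
  | 0 => 0
  | 1 => C (β 0 ^ 2)
  | k + 2 => (X - C (α (k + 1))) * numPoly α β (k + 1) - C (β (k + 1) ^ 2) * numPoly α β k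

/-- The sequence without its first term. -/
def shift (α : ℕ → ℝ) : ℕ → ℝ := fun k => α (k + 1)

theorem numPoly_succ (α β : ℕ → ℝ) (m : ℕ) :
    numPoly α β (m + 1) = C (β 0 ^ 2) * denPoly (shift α) (shift β) m := by
  induction m using Nat.twoStepInduction with
  | zero => simp [numPoly, denPoly]
  | one => simp [numPoly, denPoly, shift]; ring
  | more k h1 h2 =>
    rw [numPoly, h2, h1, denPoly]
    simp only [shift]
    ring

theorem denPoly_succ (α β : ℕ → ℝ) (m : ℕ) :
    denPoly α β (m + 1) = (X - C (α 0)) * denPoly (shift α) (shift β) m -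
      numPoly (shift α) (shift β) m := by
  induction m using Nat.twoStepInduction with
  | zero => simp [numPoly, denPoly]
  | one => simp [numPoly, denPoly, shift]; ring
  | more k h1 h2 =>
    rw [denPoly, h2, h1, denPoly, numPoly]
    simp only [shift]
    ring

theorem denPoly_congr {α α' β β' : ℕ → ℝ} {m : ℕ} (hα : ∀ k < m, α k = α' k)
    (hβ : ∀ k < m, 0 < k → β k = β' k) : denPoly α β m = denPoly α' β' m := by
  induction m using Nat.twoStepInduction with
  | zero => rfl
  | one => simp [denPoly, hα]
  | more k h1 h2 =>
    rw [denPoly, denPoly, hα (k + 1) (by omega), hβ (k + 1) (by omega) (by omega),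
      h1 (fun j hj => hα j (by omega)) (fun j hj => hβ j (by omega)),
      h2 (fun j hj => hα j (by omega)) (fun j hj => hβ j (by omega))]

theorem numPoly_congr {α α' β β' : ℕ → ℝ} {m : ℕ} (hα : ∀ k < m, α k = α' k)
    (hβ : ∀ k < m, β k = β' k) : numPoly α β m = numPoly α' β' m := by
  cases m with
  | zero => rfl
  | succ m =>
    rw [numPoly_succ, numPoly_succ, hβ 0 (by omega)]
    congr 1
    exact denPoly_congr (fun k hk => hα _ (by omega)) fun k hk _ => hβ _ (by omega)

theorem denPoly_monic_natDegree (α β : ℕ → ℝ) (m : ℕ) :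
    (denPoly α β m).Monic ∧ (denPoly α β m).degree = m := by
  induction m using Nat.twoStepInduction with
  | zero => simp [denPoly]
  | one => simp [denPoly, monic_X_sub_C]
  | more k h1 h2 =>
    rw [denPoly]
    have h3 : (C (β (k + 1) ^ 2) * denPoly α β k).degree <
        ((X - C (α (k + 1))) * denPoly α β (k + 1)).degree := by
      rw [← smul_eq_C_mul, degree_mul, degree_X_sub_C, h2.2]
      refine (degree_smul_le _ _).trans_lt ?_
      rw [h1.2]
      norm_cast
      omega
    refine ⟨((monic_X_sub_C _).mul h2.1).sub_of_left h3, ?_⟩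
    rw [degree_sub_eq_left_of_degree_lt h3, degree_mul, degree_X_sub_C, h2.2]
    push_cast
    ring

theorem denPoly_monic (α β : ℕ → ℝ) (m : ℕ) : (denPoly α β m).Monic :=
  (denPoly_monic_natDegree α β m).1

theorem degree_denPoly (α β : ℕ → ℝ) (m : ℕ) : (denPoly α β m).degree = m :=
  (denPoly_monic_natDegree α β m).2

theorem degree_numPoly_lt (α β : ℕ → ℝ) (m : ℕ) : (numPoly α β m).degree < m := by
  cases m with
  | zero => simp [numPoly]
  | succ m =>
    rw [numPoly_succ, ← smul_eq_C_mul]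
    refine (degree_smul_le _ _).trans_lt ?_
    rw [degree_denPoly]
    exact_mod_cast Nat.lt_succ_self m

/-- The Wronskian of `denPoly` and `numPoly` is positive, by the Christoffel–Darboux identity. -/
theorem wronskian_pos {m : ℕ} {α β : ℕ → ℝ} (hβ : ∀ k < m, β k ≠ 0) (hm : 0 < m) (x : ℝ) :
    0 < (derivative (denPoly α β m)).eval x * (numPoly α β m).eval x -
      (denPoly α β m).eval x * (derivative (numPoly α β m)).eval x := by
  induction m generalizing α β with
  | zero => omega
  | succ m ih =>
    have h0 : 0 < β 0 ^ 2 := sq_pos_of_ne_zero (hβ 0 (by omega))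
    have key : (derivative (denPoly α β (m + 1))).eval x * (numPoly α β (m + 1)).eval x -
        (denPoly α β (m + 1)).eval x * (derivative (numPoly α β (m + 1))).eval x =
        β 0 ^ 2 * ((denPoly (shift α) (shift β) m).eval x ^ 2 +
          ((derivative (denPoly (shift α) (shift β) m)).eval x *
            (numPoly (shift α) (shift β) m).eval x -
          (denPoly (shift α) (shift β) m).eval x *
            (derivative (numPoly (shift α) (shift β) m)).eval x)) := by
      rw [denPoly_succ, numPoly_succ]
      simp only [derivative_sub, derivative_mul, derivative_X, derivative_C, eval_sub, eval_add,
        eval_mul, eval_X, eval_C, eval_one, eval_zero]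
      ring
    rw [key]
    refine mul_pos h0 ?_
    rcases Nat.eq_zero_or_pos m with rfl | hm
    · simp [denPoly, numPoly]
    · have := ih (α := shift α) (β := shift β) (fun k hk => hβ _ (by omega)) hm
      positivity

/-- A half line whose characteristic polynomial divides a product of real linear factors gives a
positive pair. -/
theorem exists_posPair {m : ℕ} {α β : ℕ → ℝ} (hβ : ∀ k < m, β k ≠ 0) {F : ℝ[X]} (hF : F ≠ 0)
    (hs : F.Splits) (hd : denPoly α β m ∣ F) :
    ∃ Z : Finset ℝ, Z.card = m ∧ denPoly α β m = nod Z ∧ PosPair Z (numPoly α β m) := by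
  have hmon := denPoly_monic α β m
  have hsimple : ∀ x, (denPoly α β m).eval x = 0 →
      0 < (derivative (denPoly α β m)).eval x * (numPoly α β m).eval x := by
    intro x hx
    rcases Nat.eq_zero_or_pos m with rfl | hm
    · simp [denPoly] at hx
    · simpa [hx] using wronskian_pos (α := α) hβ hm x
  have hnodup : (denPoly α β m).roots.Nodup := by
    rw [Multiset.nodup_iff_count_le_one]
    intro x
    rw [count_roots]
    by_contra! h
    obtain ⟨h1, h2⟩ := (one_lt_rootMultiplicity_iff_isRoot hmon.ne_zero).1 h
    have := hsimple x h1
    rw [IsRoot.def.1 h2, zero_mul] at this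
    exact this.false
  have hsp : (denPoly α β m).Splits := hs.of_dvd hF hd
  have heq : denPoly α β m = nod ⟨_, hnodup⟩ := hsp.eq_prod_roots_of_monic hmon
  have hcard : (⟨_, hnodup⟩ : Finset ℝ).card = m := by
    have h1 := degree_denPoly α β m
    rw [heq, degree_nod] at h1
    exact_mod_cast h1
  refine ⟨⟨_, hnodup⟩, hcard, heq, ?_, fun z hz => ?_⟩
  · rw [hcard]
    exact degree_numPoly_lt α β m
  · rw [← eval_derivative_nod hz, ← heq, mul_comm]
    exact hsimple z (by rw [heq]; exact eval_nod_eq_zero.2 hz)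

/-- A half line is determined by its two polynomials. -/
theorem halfLine_unique {m : ℕ} {α β α' β' : ℕ → ℝ} (hβ : ∀ k < m, β k < 0)
    (hβ' : ∀ k < m, β' k < 0) (hD : denPoly α β m = denPoly α' β' m)
    (hB : numPoly α β m = numPoly α' β' m) : ∀ k < m, α k = α' k ∧ β k = β' k := by
  induction m generalizing α β α' β' with
  | zero => intro k hk; omega
  | succ m ih =>
    rw [numPoly_succ, numPoly_succ] at hB
    have hsq : β 0 ^ 2 = β' 0 ^ 2 := by
      have := congrArg leadingCoeff hB
      simpa [leadingCoeff_mul, (denPoly_monic _ _ _).leadingCoeff] using this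
    have h0 : β 0 = β' 0 := by
      rcases sq_eq_sq_iff_eq_or_eq_neg.1 hsq with h | h
      · exact h
      · have h1 := hβ 0 (by omega)
        have h2 := hβ' 0 (by omega)
        linarith
    have h1 : denPoly (shift α) (shift β) m = denPoly (shift α') (shift β') m := by
      rw [hsq] at hB
      refine mul_left_cancel₀ (C_ne_zero.2 ?_) hB
      exact pow_ne_zero 2 (hβ' 0 (by omega)).ne
    rw [denPoly_succ, denPoly_succ, h1] at hD
    have h2 : C (α' 0 - α 0) * denPoly (shift α') (shift β') m =
        numPoly (shift α) (shift β) m - numPoly (shift α') (shift β') m := by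
      rw [C_sub]
      linear_combination hD
    have h3 : α' 0 - α 0 = 0 := by
      by_contra hne
      have h4 := congrArg degree h2
      rw [degree_C_mul hne, degree_denPoly] at h4
      have h5 := (degree_sub_le (numPoly (shift α) (shift β) m)
        (numPoly (shift α') (shift β') m)).trans_lt
        (max_lt (degree_numPoly_lt _ _ m) (degree_numPoly_lt _ _ m))
      exact absurd h4 h5.ne'
    rw [h3, C_0, zero_mul] at h2
    have h4 := ih (α := shift α) (β := shift β) (α' := shift α') (β' := shift β')
      (fun k hk => hβ _ (by omega)) (fun k hk => hβ' _ (by omega)) h1 (sub_eq_zero.1 h2.symm)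
    intro k hk
    cases k with
    | zero => exact ⟨by linarith, h0⟩
    | succ k => exact h4 k (by omega)

/-- Positive pairs come from half lines. If the pair depends smoothly on parameters, so does the
half line, since its entries arise by rational operations and square roots from the coefficients
met in the Euclidean algorithm. -/
theorem exists_smooth_halfLine {E : Type*} [NormedAddCommGroup E] [NormedSpace ℝ E] {O : Set E}
    (m : ℕ) {D B : E → ℝ[X]} (hDs : ∀ i, ContDiffOn ℝ ∞ (fun t => (D t).coeff i) O)
    (hBs : ∀ i, ContDiffOn ℝ ∞ (fun t => (B t).coeff i) O)
    (h : ∀ t ∈ O, ∃ Z : Finset ℝ, Z.card = m ∧ D t = nod Z ∧ PosPair Z (B t)) :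
    ∃ α β : E → ℕ → ℝ, (∀ k, ContDiffOn ℝ ∞ (fun t => α t k) O) ∧
      (∀ k, ContDiffOn ℝ ∞ (fun t => β t k) O) ∧
      ∀ t ∈ O, (∀ k, β t k < 0) ∧ denPoly (α t) (β t) m = D t ∧
        numPoly (α t) (β t) m = B t := by
  induction m generalizing D B with
  | zero =>
    -- Entries outside the block are irrelevant; the value `-1` keeps them negative.
    refine ⟨fun _ _ => 0, fun _ _ => -1, fun _ => contDiffOn_const, fun _ => contDiffOn_const,
      fun t ht => ⟨fun _ => by norm_num, ?_, ?_⟩⟩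
    · obtain ⟨Z, hZ, hD, hP⟩ := h t ht
      rw [hD, Finset.card_eq_zero.1 hZ]
      simp [denPoly, nod]
    · obtain ⟨Z, hZ, hD, hP⟩ := h t ht
      have := hP.1
      rw [hZ, Nat.cast_zero, ← not_le] at this
      have h0 : B t = 0 := by
        by_contra h0
        exact this (zero_le_degree_iff.2 h0)
      rw [h0, numPoly]
  | succ m ih =>
    let c : E → ℝ := fun t => (B t).coeff m
    let D₁ : E → ℝ[X] := fun t => C (c t)⁻¹ * B t
    let a : E → ℝ := fun t => (X * D₁ t).coeff m - (D t).coeff m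
    have hc : ∀ t ∈ O, 0 < c t := fun t ht => by
      obtain ⟨Z, hZ, -, hP⟩ := h t ht
      exact hP.coeff_pos hZ
    have hD₁ : ∀ i, ContDiffOn ℝ ∞ (fun t => (D₁ t).coeff i) O := fun i => by
      simp only [D₁, coeff_C_mul]
      exact ((hBs m).inv fun t ht => (hc t ht).ne').mul (hBs i)
    have hX : ∀ i, ContDiffOn ℝ ∞ (fun t => (X * D₁ t).coeff i) O := fun i => by
      cases i with
      | zero => simpa using contDiffOn_const
      | succ i => simpa only [coeff_X_mul] using hD₁ i
    have ha : ContDiffOn ℝ ∞ a O := (hX m).sub (hDs m)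
    obtain ⟨α, β, hα, hβ, hαβ⟩ := ih (D := D₁) (B := fun t => (X - C (a t)) * D₁ t - D t) hD₁
      (fun i => by
        simp only [sub_mul, coeff_sub, coeff_C_mul]
        exact ((hX i).sub (ha.mul (hD₁ i))).sub (hDs i))
      (fun t ht => by
        obtain ⟨Z, hZ, hD, hP⟩ := h t ht
        obtain ⟨Y, hY, hB, hPY⟩ := hP.step hZ
        have h1 : D₁ t = nod Y := by
          simp only [D₁, c]
          conv_lhs => rw [hB]
          rw [← mul_assoc, coeff_C_mul, ← C_mul]
          have h2 : (nod Y).coeff m = 1 := by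
            have := (nod_monic Y).coeff_natDegree
            rwa [natDegree_nod, hY] at this
          rw [h2, mul_one, inv_mul_cancel₀ (hc t ht).ne', C_1, one_mul]
        refine ⟨Y, hY, h1, ?_⟩
        simp only [a, h1, hD]
        exact hPY)
    refine ⟨fun t k => Nat.casesOn k (a t) (α t), fun t k => Nat.casesOn k (-√(c t)) (β t),
      fun k => ?_, fun k => ?_, fun t ht => ⟨fun k => ?_, ?_, ?_⟩⟩
    · cases k with
      | zero => exact ha
      | succ k => exact hα k
    · cases k with
      | zero => exact ((hBs m).sqrt fun t ht => (hc t ht).ne').neg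
      | succ k => exact hβ k
    · cases k with
      | zero => simpa using hc t ht
      | succ k => exact (hαβ t ht).1 k
    · obtain ⟨-, h1, h2⟩ := hαβ t ht
      rw [denPoly_succ]
      change (X - C (a t)) * denPoly (α t) (β t) m - numPoly (α t) (β t) m = D t
      rw [h1, h2]
      ring
    · obtain ⟨-, h1, h2⟩ := hαβ t ht
      rw [numPoly_succ]
      change C ((-√(c t)) ^ 2) * denPoly (α t) (β t) m = B t
      rw [h1, neg_sq, Real.sq_sqrt (hc t ht).le]
      simp only [D₁]
      rw [← mul_assoc, ← C_mul, mul_inv_cancel₀ (hc t ht).ne', C_1, one_mul]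

/-! ### Jacobi matrices and their characteristic polynomials -/

/-- The symmetric tridiagonal matrix with diagonal `a` and off-diagonal `b`. -/
def jac (a b : ℕ → ℝ) (N : ℕ) : Matrix (Fin N) (Fin N) ℝ :=
  Matrix.of fun i j =>
    if i = j then a i else if i.val + 1 = j.val then b i else if j.val + 1 = i.val then b j else 0

/-- The diagonal of a matrix, continued by zero. -/
def diagSeq {N : ℕ} (J : Matrix (Fin N) (Fin N) ℝ) (i : ℕ) : ℝ :=
  if h : i < N then J ⟨i, h⟩ ⟨i, h⟩ else 0

/-- The first superdiagonal of a matrix, continued by zero. -/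
def offSeq {N : ℕ} (J : Matrix (Fin N) (Fin N) ℝ) (i : ℕ) : ℝ :=
  if h : i + 1 < N then J ⟨i, by omega⟩ ⟨i + 1, h⟩ else 0

theorem diagSeq_jac {a b : ℕ → ℝ} {N i : ℕ} (h : i < N) : diagSeq (jac a b N) i = a i := by
  simp [diagSeq, jac, h]

theorem offSeq_jac {a b : ℕ → ℝ} {N i : ℕ} (h : i + 1 < N) : offSeq (jac a b N) i = b i := by
  simp [offSeq, jac, h]

theorem jac_congr {a b a' b' : ℕ → ℝ} {N : ℕ} (ha : ∀ i < N, a i = a' i)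
    (hb : ∀ i, i + 1 < N → b i = b' i) : jac a b N = jac a' b' N := by
  ext i j
  simp only [jac, Matrix.of_apply]
  split_ifs with h1 h2 h3
  · exact ha i i.2
  · exact hb i (by omega)
  · exact hb j (by omega)
  · rfl

theorem isJacobi_jac {a b : ℕ → ℝ} {N : ℕ} (hb : ∀ i, i + 1 < N → b i < 0) :
    IsJacobi (jac a b N) where
  symm := by
    ext i j
    simp only [jac, Matrix.transpose_apply, Matrix.of_apply]
    split_ifs <;> first | rfl | omega | (subst_vars; rfl)
  eq_zero i j h := by
    have h1 : i ≠ j := fun h1 => by rw [h1] at h; omega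
    simp only [jac, Matrix.of_apply, h1, if_false]
    rw [if_neg (by omega), if_neg (by omega)]
  neg i j h := by
    have h1 : i ≠ j := fun h1 => by rw [h1] at h; omega
    simp only [jac, Matrix.of_apply, h1, if_false, h, if_true]
    exact hb i (by omega)

theorem IsJacobi.eq_jac {N : ℕ} {J : Matrix (Fin N) (Fin N) ℝ} (hJ : IsJacobi J) :
    J = jac (diagSeq J) (offSeq J) N := by
  ext i j
  simp only [jac, Matrix.of_apply]
  split_ifs with h1 h2 h3
  · simp [diagSeq, h1]
  · simp [offSeq, h2]
  · rw [← hJ.symm.apply i j]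
    simp [offSeq, h3]
  · rcases lt_or_gt_of_ne (fun h => h1 (Fin.ext h) : i.val ≠ j.val) with h | h
    · exact hJ.eq_zero i j (by omega)
    · rw [← hJ.symm.apply i j]
      exact hJ.eq_zero j i (by omega)

theorem IsJacobi.offSeq_neg {N : ℕ} {J : Matrix (Fin N) (Fin N) ℝ} (hJ : IsJacobi J) {i : ℕ}
    (h : i + 1 < N) : offSeq J i < 0 := by
  simp only [offSeq, h, dif_pos]
  exact hJ.neg _ _ rfl

theorem charpoly_jac_succ_succ (a b : ℕ → ℝ) (k : ℕ) :
    (jac a b (k + 2)).charpoly = (X - C (a (k + 1))) * (jac a b (k + 1)).charpoly -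
      C (b k ^ 2) * (jac a b k).charpoly := by
  -- Laplace expansion along the last row, which has two nonzero entries; the minor of the
  -- off-diagonal one is expanded along its last column.
  set A := (jac a b (k + 2)).charmatrix with hA
  have e1 : A.submatrix Fin.castSucc Fin.castSucc = (jac a b (k + 1)).charmatrix := by
    ext i j
    simp [hA, Matrix.charmatrix_apply, jac, Matrix.diagonal_apply]
  have e2 : A.submatrix (fun i : Fin k => i.castSucc.castSucc)
      (fun i : Fin k => i.castSucc.castSucc) = (jac a b k).charmatrix := by
    ext i j
    simp [hA, Matrix.charmatrix_apply, jac, Matrix.diagonal_apply]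
  have e3 : (A.submatrix Fin.castSucc ((Fin.last k).castSucc.succAbove)).det =
      - C (b k) * (jac a b k).charpoly := by
    rw [Matrix.det_succ_column _ (Fin.last k), Fin.sum_univ_castSucc, Finset.sum_eq_zero, zero_add]
    · have h1 : (A.submatrix Fin.castSucc ((Fin.last k).castSucc.succAbove)).submatrix
          (Fin.last k).succAbove (Fin.last k).succAbove = (jac a b k).charmatrix := by
        rw [← e2]
        ext i j
        simp only [Matrix.submatrix_apply, Fin.succAbove_last]
        congr 2
        rw [Fin.succAbove_of_castSucc_lt]
        exact Fin.castSucc_lt_castSucc_iff.2 (Fin.castSucc_lt_last j)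
      rw [h1, Matrix.charpoly, ← two_mul, pow_mul]
      simp [hA, jac, Fin.ext_iff]
    · intro i _
      have h2 : A i.castSucc.castSucc (Fin.last (k + 1)) = 0 := by
        have := i.2
        rw [hA, Matrix.charmatrix_apply, Matrix.diagonal_apply_ne _ (by simp [Fin.ext_iff]; omega)]
        simp only [jac, Matrix.of_apply]
        rw [if_neg (by simp [Fin.ext_iff]; omega), if_neg (by simp; omega),
          if_neg (by simp; omega)]
        simp
      simp [Fin.succAbove_of_le_castSucc, h2]
  rw [Matrix.charpoly, Matrix.det_succ_row _ (Fin.last (k + 1)), Fin.sum_univ_castSucc,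
    Fin.sum_univ_castSucc, Finset.sum_eq_zero, zero_add, ← hA]
  · rw [Fin.succAbove_last, e1, e3]
    simp only [Matrix.charpoly]
    have h1 : A (Fin.last (k + 1)) (Fin.last (k + 1)) = X - C (a (k + 1)) := by
      simp [hA, jac]
    have h2 : A (Fin.last (k + 1)) (Fin.last k).castSucc = - C (b k) := by
      simp [hA, jac, Fin.ext_iff]
      omega
    rw [h1, h2, ← two_mul, pow_mul]
    have h3 : ((Fin.last (k + 1) : Fin (k + 2)) : ℕ) + ((Fin.last k).castSucc : Fin (k + 2)) =
      2 * k + 1 := by simp; omega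
    rw [h3, pow_succ, pow_mul, C_pow]
    ring
  · intro i _
    have h2 : (jac a b (k + 2)).charmatrix (Fin.last (k + 1)) i.castSucc.castSucc = 0 := by
      have := i.2
      rw [Matrix.charmatrix_apply, Matrix.diagonal_apply_ne _ (by simp [Fin.ext_iff]; omega)]
      simp only [jac, Matrix.of_apply]
      rw [if_neg (by simp [Fin.ext_iff]; omega), if_neg (by simp; omega),
        if_neg (by simp; omega)]
      simp
    simp [h2]

theorem charpoly_jac (a b : ℕ → ℝ) (m : ℕ) :
    (jac a b m).charpoly = denPoly a (fun k => b (k - 1)) m := by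
  induction m using Nat.twoStepInduction with
  | zero => simp [denPoly]
  | one => simp [denPoly, Matrix.charpoly, jac]
  | more k h1 h2 => rw [charpoly_jac_succ_succ, h1, h2, denPoly, Nat.add_sub_cancel]

/-- The terms `s (n - 1), …, s 0` in this order, which go outward from the site `n` to the left. -/
def revSeq (s : ℕ → ℝ) (n : ℕ) : ℕ → ℝ := fun k => s (n - 1 - k)

/-- The terms `s n, s (n + 1), …`. -/
def tailSeq (s : ℕ → ℝ) (n : ℕ) : ℕ → ℝ := fun k => s (n + k)

theorem shift_revSeq (s : ℕ → ℝ) (n : ℕ) : shift (revSeq s (n + 1)) = revSeq s n := by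
  funext k
  simp only [shift, revSeq]
  congr 1
  omega

theorem denPoly_revSeq (a b : ℕ → ℝ) (n : ℕ) :
    denPoly (revSeq a n) (revSeq b n) n = denPoly a (fun k => b (k - 1)) n := by
  induction n using Nat.twoStepInduction with
  | zero => rfl
  | one => simp [denPoly, revSeq]
  | more k h1 h2 =>
    rw [denPoly_succ, shift_revSeq, shift_revSeq, h2, numPoly_succ, shift_revSeq, shift_revSeq, h1]
    simp [denPoly, revSeq]

theorem denPoly_succ_revSeq (a b : ℕ → ℝ) (n : ℕ) :
    denPoly a (fun k => b (k - 1)) (n + 1) =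
      (X - C (a n)) * denPoly (revSeq a n) (revSeq b n) n -
        numPoly (revSeq a n) (revSeq b n) n := by
  cases n with
  | zero => simp [denPoly, numPoly]
  | succ k =>
    rw [numPoly_succ, shift_revSeq, shift_revSeq, denPoly_revSeq, denPoly_revSeq]
    simp [denPoly, revSeq]

/-- Splitting a Jacobi matrix at the site `n`: the characteristic polynomial in terms of the two
half lines that start next to `n` and go outward. -/
theorem charpoly_jac_split (a b : ℕ → ℝ) {N n m : ℕ} (hN : n + 1 + m = N) :
    (jac a b N).charpoly =
      (X - C (a n)) * denPoly (revSeq a n) (revSeq b n) n *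
          denPoly (tailSeq a (n + 1)) (tailSeq b n) m -
        numPoly (revSeq a n) (revSeq b n) n * denPoly (tailSeq a (n + 1)) (tailSeq b n) m -
        denPoly (revSeq a n) (revSeq b n) n * numPoly (tailSeq a (n + 1)) (tailSeq b n) m := by
  subst hN
  rw [charpoly_jac]
  induction m using Nat.twoStepInduction with
  | zero => simp [denPoly_succ_revSeq, denPoly, numPoly]
  | one =>
    have h : denPoly a (fun k => b (k - 1)) (n + 1 + 1) =
        (X - C (a (n + 1))) * denPoly a (fun k => b (k - 1)) (n + 1) -
          C (b n ^ 2) * denPoly a (fun k => b (k - 1)) n := rfl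
    rw [h, denPoly_succ_revSeq, ← denPoly_revSeq]
    simp only [denPoly, numPoly, tailSeq, add_zero]
    ring
  | more k h1 h2 =>
    have e : n + 1 + (k + 2) = (n + 1 + k) + 2 := by ring
    rw [e, denPoly, h1, add_assoc (n + 1) k 1, h2]
    simp only [denPoly, numPoly, tailSeq]
    have e2 : n + (k + 1) = n + 1 + (k + 1) - 1 := by omega
    rw [e2]
    ring

theorem perturb_jac (a b : ℕ → ℝ) {N : ℕ} (n : Fin N) (θ K : ℝ) :
    perturb n θ K (jac a b N) =
      jac (fun i => if i = n then θ ^ 2 * (a n + ((θ ^ 2)⁻¹ - 1) * K) else a i)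
        (fun i => if i = n ∨ i + 1 = n then θ * b i else b i) N := by
  ext i j
  simp only [perturb, jac, Matrix.of_apply, Fin.ext_iff, if_true]
  by_cases h1 : i.val = n <;> by_cases h2 : j.val = n <;> by_cases h3 : i.val = j.val <;>
    by_cases h4 : i.val + 1 = j.val <;> by_cases h5 : j.val + 1 = i.val <;>
    simp_all

/-! ### Open boxes, balls and disjoint unions of balls -/

/-- The open unit cube. -/
def openBox (d : ℕ) : Set (EuclideanSpace ℝ (Fin d)) := {t | ∀ i, t i ∈ Set.Ioo (0 : ℝ) 1}

theorem isOpen_openBox (d : ℕ) : IsOpen (openBox d) := by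
  have : openBox d = ⋂ i, (fun t : EuclideanSpace ℝ (Fin d) => t i) ⁻¹' Set.Ioo 0 1 := by
    ext t; simp [openBox]
  rw [this]
  exact isOpen_iInter_of_finite fun i => isOpen_Ioo.preimage (by fun_prop)

/-- The coordinatewise logistic function, a diffeomorphism of the whole space onto the cube. -/
def logistic {d : ℕ} (y : EuclideanSpace ℝ (Fin d)) : EuclideanSpace ℝ (Fin d) :=
  WithLp.toLp 2 fun i => Real.sigmoid (y i)

/-- The inverse of `logistic` on the cube. -/
def logit {d : ℕ} (t : EuclideanSpace ℝ (Fin d)) : EuclideanSpace ℝ (Fin d) :=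
  WithLp.toLp 2 fun i => Real.log (t i) - Real.log (1 - t i)

theorem logistic_mem {d : ℕ} (y : EuclideanSpace ℝ (Fin d)) : logistic y ∈ openBox d :=
  fun _ => ⟨Real.sigmoid_pos _, Real.sigmoid_lt_one _⟩

theorem logit_logistic {d : ℕ} (y : EuclideanSpace ℝ (Fin d)) : logit (logistic y) = y := by
  ext i
  simp only [logit, logistic]
  have h := Real.sigmoid_mul_rexp_neg (y i)
  rw [Real.sigmoid_neg] at h
  rw [← h, Real.log_mul (Real.sigmoid_pos _).ne' (Real.exp_pos _).ne', Real.log_exp]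
  ring

theorem logistic_logit {d : ℕ} {t : EuclideanSpace ℝ (Fin d)} (ht : t ∈ openBox d) :
    logistic (logit t) = t := by
  ext i
  have h1 := (ht i).1
  have h2 := (ht i).2
  simp only [logit, logistic, Real.sigmoid_def]
  rw [neg_sub, Real.exp_sub, Real.exp_log h1, Real.exp_log (by linarith)]
  field_simp
  ring

theorem contDiff_logistic {d : ℕ} :
    ContDiff ℝ ∞ (logistic : EuclideanSpace ℝ (Fin d) → EuclideanSpace ℝ (Fin d)) := by
  rw [contDiff_euclidean]
  intro i
  simp only [logistic, Real.sigmoid_def]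
  refine ContDiff.inv (by fun_prop) fun y => ?_
  positivity

theorem contDiffOn_logit {d : ℕ} :
    ContDiffOn ℝ ∞ (logit : EuclideanSpace ℝ (Fin d) → EuclideanSpace ℝ (Fin d)) (openBox d) := by
  rw [contDiffOn_euclidean]
  intro i
  simp only [logit]
  refine ContDiffOn.sub (ContDiffOn.log (by fun_prop) fun t ht => (ht i).1.ne')
    (ContDiffOn.log (by fun_prop) fun t ht => (sub_pos.2 (ht i).2).ne')

theorem isBallManifold_of_openBox {d : ℕ} {E : Type*} [NormedAddCommGroup E] [NormedSpace ℝ E]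
    {X : Set E} {φ : EuclideanSpace ℝ (Fin d) → E} {ψ : E → EuclideanSpace ℝ (Fin d)}
    (hφ : ContDiffOn ℝ ∞ φ (openBox d)) (hψ : ContDiff ℝ ∞ ψ)
    (h1 : Set.MapsTo φ (openBox d) X) (h2 : Set.MapsTo ψ X (openBox d))
    (h3 : Set.InvOn ψ φ (openBox d) X) : IsBallManifold d X := by
  let u : OpenPartialHomeomorph (EuclideanSpace ℝ (Fin d)) (EuclideanSpace ℝ (Fin d)) :=
    OpenPartialHomeomorph.univUnitBall
  have hu : ∀ y, u y ∈ Metric.ball 0 1 := fun y => u.map_source (Set.mem_univ y)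
  refine ⟨fun x => φ (logistic (u.symm x)), fun e => u (logit (ψ e)), ψ ⁻¹' openBox d,
    ?_, (isOpen_openBox d).preimage hψ.continuous, h2, ?_, ?_, ?_, ?_, ?_⟩
  · exact hφ.comp (contDiff_logistic.comp_contDiffOn
      OpenPartialHomeomorph.contDiffOn_univUnitBall_symm) fun x _ => logistic_mem _
  · exact OpenPartialHomeomorph.contDiff_univUnitBall.comp_contDiffOn
      (contDiffOn_logit.comp hψ.contDiffOn fun e he => he)
  · exact fun x _ => h1 (logistic_mem _)
  · exact fun e _ => hu _
  · intro x hx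
    simp only
    rw [h3.1 (logistic_mem _), logit_logistic]
    exact u.right_inv hx
  · intro e he
    simp only
    rw [u.left_inv (Set.mem_univ _), logistic_logit (h2 he), h3.2 he]

theorem IsDisjointUnionOfBalls.infinite {c d : ℕ} {E : Type*} [NormedAddCommGroup E]
    [NormedSpace ℝ E] {S : Set E} (h : IsDisjointUnionOfBalls c d S) (hc : 0 < c) (hd : d ≠ 0) :
    S.Infinite := by
  obtain ⟨X, -, rfl, h⟩ := h
  obtain ⟨-, φ, ψ, U, -, -, -, -, h1, -, h2⟩ := h ⟨0, hc⟩
  have : NeZero d := ⟨hd⟩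
  have hball : (Metric.ball (0 : EuclideanSpace ℝ (Fin d)) 1).Infinite :=
    infinite_of_mem_nhds 0 (Metric.ball_mem_nhds _ one_pos)
  exact ((hball.image h2.1.injOn).mono h1.image_subset).mono (Set.subset_iUnion X _)

theorem IsDisjointUnionOfBalls.finite_ncard {c : ℕ} {E : Type*} [NormedAddCommGroup E]
    [NormedSpace ℝ E] {S : Set E} (h : IsDisjointUnionOfBalls c 0 S) :
    S.Finite ∧ S.ncard = c := by
  obtain ⟨X, hX, rfl, h⟩ := h
  have hs : ∀ i, ∃ x, X i = {x} := fun i => by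
    obtain ⟨-, φ, ψ, U, -, -, -, -, h1, -, h2⟩ := h i
    refine ⟨φ 0, Set.eq_singleton_iff_unique_mem.2
      ⟨h1 (Metric.mem_ball_self one_pos), fun y hy => ?_⟩⟩
    rw [← h2.2 hy, Subsingleton.elim (ψ y) 0]
  choose x hx using hs
  have hinj : Function.Injective x := fun i j hij => by
    by_contra hne
    have : Disjoint (X i) (X j) := hX hne
    rw [hx, hx, hij] at this
    simp at this
  have hU : (⋃ i, X i) = Set.range x := by
    ext y; simp [hx, eq_comm]
  rw [hU]
  exact ⟨Set.finite_range x, by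
    rw [← Set.image_univ, Set.ncard_image_of_injective _ hinj, Set.ncard_univ]; simp⟩

/-! ### The two half lines of a matrix -/

theorem spectrum_eq_iff {N : ℕ} (M : Matrix (Fin N) (Fin N) ℝ) {Y : Finset ℝ}
    (hY : Y.card = N) : spectrum ℝ M = (Y : Set ℝ) ↔ M.charpoly = nod Y := by
  constructor
  · intro h
    refine eq_of_degree_sub_lt_of_eval_finset_eq Y ?_ fun y hy => ?_
    · have h1 : M.charpoly.degree = (nod Y).degree := by
        rw [degree_nod, hY, Matrix.charpoly_degree_eq_dim, Fintype.card_fin]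
      have h2 := degree_sub_lt_left h1 (Matrix.charpoly_monic M).ne_zero
        ((Matrix.charpoly_monic M).leadingCoeff.trans (nod_monic Y).leadingCoeff.symm)
      rwa [h1, degree_nod] at h2
    · rw [eval_nod_eq_zero.2 hy]
      have : y ∈ spectrum ℝ M := by rw [h]; exact hy
      exact Matrix.mem_spectrum_iff_isRoot_charpoly.1 this
  · intro h
    ext x
    rw [Matrix.mem_spectrum_iff_isRoot_charpoly, h, IsRoot.def, eval_nod_eq_zero, Finset.mem_coe]

variable {N : ℕ}

/-- `denPoly` of the half line to the left of the site `n`. -/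
def leftDen (n : ℕ) (J : Matrix (Fin N) (Fin N) ℝ) : ℝ[X] :=
  denPoly (revSeq (diagSeq J) n) (revSeq (offSeq J) n) n

/-- `numPoly` of the half line to the left of the site `n`. -/
def leftNum (n : ℕ) (J : Matrix (Fin N) (Fin N) ℝ) : ℝ[X] :=
  numPoly (revSeq (diagSeq J) n) (revSeq (offSeq J) n) n

/-- `denPoly` of the half line to the right of the site `n`. -/
def rightDen (n : ℕ) (J : Matrix (Fin N) (Fin N) ℝ) : ℝ[X] :=
  denPoly (tailSeq (diagSeq J) (n + 1)) (tailSeq (offSeq J) n) (N - n - 1)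

/-- `numPoly` of the half line to the right of the site `n`. -/
def rightNum (n : ℕ) (J : Matrix (Fin N) (Fin N) ℝ) : ℝ[X] :=
  numPoly (tailSeq (diagSeq J) (n + 1)) (tailSeq (offSeq J) n) (N - n - 1)

theorem IsJacobi.left_neg {J : Matrix (Fin N) (Fin N) ℝ} (hJ : IsJacobi J) {n : ℕ} (hn : n < N) :
    ∀ k < n, revSeq (offSeq J) n k < 0 :=
  fun k hk => IsJacobi.offSeq_neg hJ (by omega)

theorem IsJacobi.right_neg {J : Matrix (Fin N) (Fin N) ℝ} (hJ : IsJacobi J) {n : ℕ} :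
    ∀ k < N - n - 1, tailSeq (offSeq J) n k < 0 :=
  fun k hk => IsJacobi.offSeq_neg hJ (by omega)

theorem IsJacobi.charpoly_eq {J : Matrix (Fin N) (Fin N) ℝ} (hJ : IsJacobi J) (n : Fin N) :
    J.charpoly = (X - C (J n n)) * leftDen n J * rightDen n J - leftNum n J * rightDen n J -
      leftDen n J * rightNum n J := by
  conv_lhs => rw [IsJacobi.eq_jac hJ,
    charpoly_jac_split _ _ (show n.val + 1 + (N - n - 1) = N by omega)]
  simp [leftDen, rightDen, leftNum, rightNum, diagSeq]

/-- A Jacobi matrix is determined by its diagonal entry at `n` and the polynomials of its half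
lines. -/
theorem IsJacobi.ext {J J' : Matrix (Fin N) (Fin N) ℝ} (hJ : IsJacobi J) (hJ' : IsJacobi J')
    (n : Fin N) (h : J n n = J' n n) (h1 : leftDen n J = leftDen n J')
    (h2 : leftNum n J = leftNum n J') (h3 : rightDen n J = rightDen n J')
    (h4 : rightNum n J = rightNum n J') : J = J' := by
  have hL := halfLine_unique (IsJacobi.left_neg hJ n.2) (IsJacobi.left_neg hJ' n.2) h1 h2
  have hR := halfLine_unique (IsJacobi.right_neg hJ) (IsJacobi.right_neg hJ') h3 h4
  rw [IsJacobi.eq_jac hJ, IsJacobi.eq_jac hJ']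
  refine jac_congr (fun i hi => ?_) fun i hi => ?_
  · rcases lt_trichotomy i n with hin | hin | hin
    · have := (hL (n - 1 - i) (by omega)).1
      rwa [revSeq, revSeq, show n.val - 1 - (n - 1 - i) = i by omega] at this
    · subst hin
      simpa [diagSeq] using h
    · have := (hR (i - n - 1) (by omega)).1
      rwa [tailSeq, tailSeq, show n.val + 1 + (i - n - 1) = i by omega] at this
  · rcases lt_or_ge i n with hin | hin
    · have := (hL (n - 1 - i) (by omega)).2
      rwa [revSeq, revSeq, show n.val - 1 - (n - 1 - i) = i by omega] at this
    · have := (hR (i - n) (by omega)).2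
      rwa [tailSeq, tailSeq, show n.val + (i - n) = i by omega] at this

/-- The Jacobi matrix with given half lines on both sides of the diagonal entry `a` at `n`. -/
def glueJac (N n : ℕ) (αL βL : ℕ → ℝ) (a : ℝ) (αR βR : ℕ → ℝ) : Matrix (Fin N) (Fin N) ℝ :=
  jac (fun i => if i < n then αL (n - 1 - i) else if i = n then a else αR (i - n - 1))
    (fun i => if i < n then βL (n - 1 - i) else βR (i - n)) N

section glue

variable {αL βL αR βR : ℕ → ℝ} {a : ℝ} {n : ℕ}

theorem isJacobi_glueJac (hL : ∀ k, βL k < 0) (hR : ∀ k, βR k < 0) :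
    IsJacobi (glueJac N n αL βL a αR βR) :=
  isJacobi_jac fun i _ => by
    split_ifs
    · exact hL _
    · exact hR _

theorem glueJac_apply (n : Fin N) : glueJac N n αL βL a αR βR n n = a := by
  simp [glueJac, jac]

theorem revSeq_diagSeq_glueJac (hn : n < N) {k : ℕ} (hk : k < n) :
    revSeq (diagSeq (glueJac N n αL βL a αR βR)) n k = αL k := by
  rw [revSeq, glueJac, diagSeq_jac (by omega), if_pos (by omega)]
  congr 1; omega

theorem revSeq_offSeq_glueJac (hn : n < N) {k : ℕ} (hk : k < n) :
    revSeq (offSeq (glueJac N n αL βL a αR βR)) n k = βL k := by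
  rw [revSeq, glueJac, offSeq_jac (by omega), if_pos (by omega)]
  congr 1; omega

theorem tailSeq_diagSeq_glueJac {k : ℕ} (hk : k < N - n - 1) :
    tailSeq (diagSeq (glueJac N n αL βL a αR βR)) (n + 1) k = αR k := by
  rw [tailSeq, glueJac, diagSeq_jac (by omega), if_neg (by omega), if_neg (by omega)]
  congr 1; omega

theorem tailSeq_offSeq_glueJac {k : ℕ} (hk : k < N - n - 1) :
    tailSeq (offSeq (glueJac N n αL βL a αR βR)) n k = βR k := by
  rw [tailSeq, glueJac, offSeq_jac (by omega), if_neg (by omega)]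
  congr 1; omega

theorem leftDen_glueJac (hn : n < N) :
    leftDen n (glueJac N n αL βL a αR βR) = denPoly αL βL n :=
  denPoly_congr (fun _ hk => revSeq_diagSeq_glueJac hn hk)
    fun _ hk _ => revSeq_offSeq_glueJac hn hk

theorem leftNum_glueJac (hn : n < N) :
    leftNum n (glueJac N n αL βL a αR βR) = numPoly αL βL n :=
  numPoly_congr (fun _ hk => revSeq_diagSeq_glueJac hn hk)
    fun _ hk => revSeq_offSeq_glueJac hn hk

theorem rightDen_glueJac :
    rightDen n (glueJac N n αL βL a αR βR) = denPoly αR βR (N - n - 1) :=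
  denPoly_congr (fun _ hk => tailSeq_diagSeq_glueJac hk) fun _ hk _ => tailSeq_offSeq_glueJac hk

theorem rightNum_glueJac :
    rightNum n (glueJac N n αL βL a αR βR) = numPoly αR βR (N - n - 1) :=
  numPoly_congr (fun _ hk => tailSeq_diagSeq_glueJac hk) fun _ hk => tailSeq_offSeq_glueJac hk

end glue

/-! ### The perturbation -/

theorem isJacobi_perturb {J : Matrix (Fin N) (Fin N) ℝ} (hJ : IsJacobi J) (n : Fin N) {θ : ℝ}
    (hθ : 0 < θ) (K : ℝ) : IsJacobi (perturb n θ K J) := by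
  rw [IsJacobi.eq_jac hJ, perturb_jac]
  refine isJacobi_jac fun i hi => ?_
  have := IsJacobi.offSeq_neg hJ hi
  split_ifs
  · exact mul_neg_of_pos_of_neg hθ this
  · exact this

theorem numPoly_scale {α α' β β' : ℕ → ℝ} {θ : ℝ} {m : ℕ} (hα : ∀ k < m, α' k = α k)
    (h0 : 0 < m → β' 0 = θ * β 0) (h : ∀ k < m, 0 < k → β' k = β k) :
    numPoly α' β' m = C (θ ^ 2) * numPoly α β m := by
  cases m with
  | zero => simp [numPoly]
  | succ m =>
    rw [numPoly_succ, numPoly_succ, h0 (by omega), mul_pow, C_mul, mul_assoc]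
    congr 2
    exact denPoly_congr (fun _ _ => hα _ (by omega)) fun k hk _ => h _ (by omega) (by omega)

/-- The perturbation multiplies both `numPoly` by `θ ^ 2` and leaves both `denPoly` unchanged. -/
theorem IsJacobi.charpoly_perturb {J : Matrix (Fin N) (Fin N) ℝ} (hJ : IsJacobi J) (n : Fin N)
    {θ : ℝ} (hθ : 0 < θ) (K : ℝ) :
    (perturb n θ K J).charpoly = C (θ ^ 2) * J.charpoly +
      C (1 - θ ^ 2) * ((X - C K) * (leftDen n J * rightDen n J)) := by
  have hP := isJacobi_perturb hJ n hθ K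
  rw [IsJacobi.charpoly_eq hP n, IsJacobi.charpoly_eq hJ n]
  have hd : ∀ i, i ≠ n.val → diagSeq (perturb n θ K J) i = diagSeq J i := by
    intro i hi
    simp only [diagSeq]
    split_ifs with h
    · have : (⟨i, h⟩ : Fin N) ≠ n := fun h1 => hi (by rw [← h1])
      simp [perturb, this]
    · rfl
  have ho : ∀ i, i ≠ n.val → i + 1 ≠ n → offSeq (perturb n θ K J) i = offSeq J i := by
    intro i hi hi'
    simp only [offSeq]
    split_ifs with h
    · have h1 : (⟨i, by omega⟩ : Fin N) ≠ n := fun h1 => hi (by rw [← h1])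
      have h2 : (⟨i + 1, h⟩ : Fin N) ≠ n := fun h1 => hi' (by rw [← h1])
      simp [perturb, h1, h2]
    · rfl
  have ho' : ∀ i, i = n.val ∨ i + 1 = n →
      offSeq (perturb n θ K J) i = θ * offSeq J i := by
    intro i hi
    simp only [offSeq]
    split_ifs with h
    · have h1 : (⟨i, by omega⟩ : Fin N) = n ∨ (⟨i + 1, h⟩ : Fin N) = n := by
        simpa [Fin.ext_iff] using hi
      have h2 : ¬ ((⟨i, by omega⟩ : Fin N) = n ∧ (⟨i + 1, h⟩ : Fin N) = n) := by
        simp only [Fin.ext_iff]; omega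
      simp only [perturb, Matrix.of_apply, h1, h2, if_true, if_false]
    · simp
  have e1 : leftDen n (perturb n θ K J) = leftDen n J :=
    denPoly_congr (fun k hk => hd _ (by omega)) fun k hk h0 => ho _ (by omega) (by omega)
  have e2 : rightDen n (perturb n θ K J) = rightDen n J :=
    denPoly_congr (fun k hk => hd _ (by omega)) fun k hk h0 => ho _ (by omega) (by omega)
  have e3 : leftNum n (perturb n θ K J) = C (θ ^ 2) * leftNum n J := by
    exact numPoly_scale (fun k hk => hd _ (by omega)) (fun h => ho' _ (by omega))
      fun k hk h => ho _ (by omega) (by omega)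
  have e4 : rightNum n (perturb n θ K J) = C (θ ^ 2) * rightNum n J := by
    exact numPoly_scale (fun k hk => hd _ (by omega)) (fun h => ho' _ (by omega))
      fun k hk h => ho _ (by omega) (by omega)
  have e5 : perturb n θ K J n n = θ ^ 2 * J n n + (1 - θ ^ 2) * K := by
    have : θ ^ 2 * (θ ^ 2)⁻¹ = 1 := mul_inv_cancel₀ (by positivity)
    simp only [perturb, Matrix.of_apply, and_self, if_true]
    linear_combination K * this
  rw [e1, e2, e3, e4, e5]
  simp only [C_add, C_mul, C_sub, C_1]
  ring

/-! ### Distributing poles and residues over the two half lines -/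

theorem residue_residuePoly {Z : Finset ℝ} (w : ℝ → ℝ) {z : ℝ} (hz : z ∈ Z) :
    residue Z (residuePoly Z w) z = w z := by
  rw [residue, eval_residuePoly w hz, mul_div_cancel_right₀ _ (eval_nod_erase_self_ne_zero Z z)]

theorem residuePoly_add (Z : Finset ℝ) (v w : ℝ → ℝ) :
    residuePoly Z v + residuePoly Z w = residuePoly Z (fun z => v z + w z) := by
  simp only [residuePoly, ← Finset.sum_add_distrib, C_add, add_mul]

theorem residuePoly_mul_nod_sdiff {Y Z : Finset ℝ} (h : Y ⊆ Z) (w : ℝ → ℝ) :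
    residuePoly Y w * nod (Z \ Y) = residuePoly Z (fun z => if z ∈ Y then w z else 0) := by
  rw [residuePoly, residuePoly, Finset.sum_mul, ← Finset.sum_subset h]
  · refine Finset.sum_congr rfl fun z hz => ?_
    rw [if_pos hz, mul_assoc, ← nod_union]
    · congr 2
      ext x
      simp only [Finset.mem_union, Finset.mem_erase, Finset.mem_sdiff]
      constructor
      · rintro (⟨h1, h2⟩ | ⟨h1, h2⟩)
        · exact ⟨h1, h h2⟩
        · exact ⟨fun h3 => h2 (h3 ▸ hz), h1⟩
      · rintro ⟨h1, h2⟩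
        by_cases h3 : x ∈ Y
        · exact Or.inl ⟨h1, h3⟩
        · exact Or.inr ⟨h2, h3⟩
    · exact Finset.disjoint_sdiff.mono_left (Finset.erase_subset _ _)
  · intro z _ hz
    simp [hz]

/-- Comparing multiplicities: the simple roots of `nod Z * nod W` lie in exactly one, and the
double roots in both of the factors `nod Y`, `nod Y'`. -/
theorem sdiff_of_nod_mul_eq {Y Y' Z W : Finset ℝ} (hW : W ⊆ Z)
    (h : nod Y * nod Y' = nod Z * nod W) : W ⊆ Y ∧ Y ⊆ Z ∧ Y' = Z \ (Y \ W) := by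
  have hr := congrArg roots h
  rw [roots_mul (mul_ne_zero (nod_ne_zero _) (nod_ne_zero _)),
    roots_mul (mul_ne_zero (nod_ne_zero _) (nod_ne_zero _))] at hr
  simp only [roots_nod] at hr
  have hcount : ∀ x, (if x ∈ Y then 1 else 0) + (if x ∈ Y' then 1 else 0) =
      (if x ∈ Z then 1 else 0) + (if x ∈ W then 1 else 0) := fun x => by
    have h1 := congrArg (Multiset.count x) hr
    simpa only [Multiset.count_add, Multiset.count_eq_of_nodup (Finset.nodup _),
      Finset.mem_val] using h1
  refine ⟨fun x hx => ?_, fun x hx => ?_, ?_⟩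
  · have := hcount x
    by_contra h1
    simp only [hx, hW hx, h1, if_true, if_false] at this
    split_ifs at this <;> omega
  · have := hcount x
    by_contra h1
    have h2 : x ∉ W := fun h2 => h1 (hW h2)
    simp only [hx, h1, h2, if_true, if_false] at this
    split_ifs at this <;> omega
  · ext x
    have := hcount x
    have h2 : x ∈ W → x ∈ Z := @hW x
    simp only [Finset.mem_sdiff]
    by_cases h3 : x ∈ Y <;> by_cases h4 : x ∈ Y' <;> by_cases h5 : x ∈ Z <;>
      by_cases h6 : x ∈ W <;> simp_all

theorem nod_mul_nod_of_subset {A Z W : Finset ℝ} (hA : A ⊆ Z \ W) :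
    nod (A ∪ W) * nod (Z \ A) = nod Z * nod W := by
  have hAW : Disjoint A W := (Finset.subset_sdiff.1 hA).2
  have hAZ : A ⊆ Z := (Finset.subset_sdiff.1 hA).1
  have h1 : nod A * nod (Z \ A) = nod Z := by
    rw [← nod_union Finset.disjoint_sdiff, Finset.union_sdiff_of_subset hAZ]
  rw [nod_union hAW, ← h1]
  ring

/-- The condition on the characteristic polynomial says that the residues of the two half lines
add up to the prescribed ones. -/
theorem split_iff {A Z W : Finset ℝ} (hW : W ⊆ Z) (hA : A ⊆ Z \ W) {R BL BR : ℝ[X]}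
    {a a' : ℝ} (hR : R.degree < Z.card) (hBL : BL.degree < (A ∪ W).card)
    (hBR : BR.degree < (Z \ A).card) :
    (X - C a') * nod (A ∪ W) * nod (Z \ A) - BL * nod (Z \ A) - nod (A ∪ W) * BR =
        nod W * ((X - C a) * nod Z - R) ↔
      a' = a ∧ ∀ z ∈ Z, (if z ∈ A ∪ W then residue (A ∪ W) BL z else 0) +
        (if z ∈ Z \ A then residue (Z \ A) BR z else 0) = residue Z R z := by
  have hAW : Disjoint A W := (Finset.subset_sdiff.1 hA).2
  have hAZ : A ⊆ Z := (Finset.subset_sdiff.1 hA).1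
  have e1 : nod (Z \ A) = nod W * nod (Z \ (A ∪ W)) := by
    rw [← nod_union]
    · congr 1
      ext x
      have h1 : x ∈ W → x ∉ A := fun h1 h2 => Finset.disjoint_left.1 hAW h2 h1
      have h2 : x ∈ W → x ∈ Z := @hW x
      simp only [Finset.mem_sdiff, Finset.mem_union]
      tauto
    · exact Finset.disjoint_sdiff.mono_left Finset.subset_union_right
  have e2 : nod Z = nod A * nod (Z \ A) := by
    rw [← nod_union Finset.disjoint_sdiff, Finset.union_sdiff_of_subset hAZ]
  set v : ℝ → ℝ := fun z => (if z ∈ A ∪ W then residue (A ∪ W) BL z else 0) +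
        (if z ∈ Z \ A then residue (Z \ A) BR z else 0) with hv
  have e3 : BL * nod (Z \ (A ∪ W)) + nod A * BR = residuePoly Z v := by
    have h1 := residuePoly_mul_nod_sdiff (Y := A ∪ W) (Z := Z) (Finset.union_subset hAZ hW)
      (residue (A ∪ W) BL)
    have h2 := residuePoly_mul_nod_sdiff (Y := Z \ A) (Z := Z) Finset.sdiff_subset
      (residue (Z \ A) BR)
    rw [← eq_residuePoly_residue hBL] at h1
    rw [← eq_residuePoly_residue hBR, Finset.sdiff_sdiff_eq_self hAZ] at h2
    rw [h1, mul_comm, h2, residuePoly_add]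
  have e4 : (X - C a') * nod (A ∪ W) * nod (Z \ A) - BL * nod (Z \ A) - nod (A ∪ W) * BR =
      nod W * ((X - C a') * nod Z - residuePoly Z v) := by
    rw [← e3, e2, e1, nod_union hAW]
    ring
  rw [e4, mul_right_inj' (nod_ne_zero W)]
  constructor
  · intro h
    have h1 : C (a - a') * nod Z = residuePoly Z v - R := by
      rw [C_sub]
      linear_combination h
    have h2 : a - a' = 0 := by
      by_contra hne
      have h3 := congrArg degree h1
      rw [degree_C_mul hne, degree_nod] at h3
      exact absurd h3 ((degree_sub_le _ _).trans_lt (max_lt (degree_residuePoly_lt Z v) hR)).ne'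
    rw [h2, C_0, zero_mul] at h1
    refine ⟨by linarith, fun z hz => ?_⟩
    rw [← sub_eq_zero.1 h1.symm, residue_residuePoly v hz]
  · rintro ⟨rfl, h⟩
    rw [residuePoly_congr (w := residue Z R) h, ← eq_residuePoly_residue hR]

/-! ### The components of the inverse spectral family -/

/-- The form in which the spectral data enter the construction. Here `W` is the set of double
zeros of `nod Z * nod W`, which is the characteristic polynomial of any solution with row and
column `n` removed, and `(X - a) - R / nod Z` is the reciprocal of the entry `(n, n)` of the
resolvent `(x - J)⁻¹` of any solution `J`. -/
structure SplitData (n : Fin N) (lam lamh : Fin N → ℝ) (K θ : ℝ) (Z W : Finset ℝ)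
    (R : ℝ[X]) (a : ℝ) : Prop where
  mono : StrictMono lam
  monoh : StrictMono lamh
  theta_pos : 0 < θ
  theta_lt : θ ^ 2 < 1
  subset : W ⊆ Z
  card : Z.card + W.card + 1 = N
  card_le : W.card ≤ n
  posPair : PosPair Z R
  char_eq : nod (pts lam) = nod W * ((X - C a) * nod Z - R)
  charh_eq : nod (pts lamh) = C (θ ^ 2) * nod (pts lam) +
    C (1 - θ ^ 2) * ((X - C K) * (nod Z * nod W))

theorem card_pts {lam : Fin N → ℝ} (h : StrictMono lam) : (pts lam).card = N := by
  rw [pts, Finset.card_image_of_injective _ h.injective, Finset.card_univ, Fintype.card_fin]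

theorem contDiff_entry (i j : Fin N) : ContDiff ℝ ∞
    (fun P : Matrix (Fin N) (Fin N) ℝ × Matrix (Fin N) (Fin N) ℝ => P.1 i j) :=
  (contDiff_apply_apply ℝ ℝ i j).comp contDiff_fst

theorem contDiff_diagSeq (i : ℕ) : ContDiff ℝ ∞
    (fun P : Matrix (Fin N) (Fin N) ℝ × Matrix (Fin N) (Fin N) ℝ => diagSeq P.1 i) := by
  unfold diagSeq
  split_ifs
  · exact contDiff_entry _ _
  · exact contDiff_const

theorem contDiff_offSeq (i : ℕ) : ContDiff ℝ ∞
    (fun P : Matrix (Fin N) (Fin N) ℝ × Matrix (Fin N) (Fin N) ℝ => offSeq P.1 i) := by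
  unfold offSeq
  split_ifs
  · exact contDiff_entry _ _
  · exact contDiff_const

section eval

variable {E : Type*} [NormedAddCommGroup E] [NormedSpace ℝ E] {α β : E → ℕ → ℝ}

theorem contDiff_eval_denPoly (hα : ∀ k, ContDiff ℝ ∞ fun t => α t k)
    (hβ : ∀ k, ContDiff ℝ ∞ fun t => β t k) (m : ℕ) (x : ℝ) :
    ContDiff ℝ ∞ fun t => (denPoly (α t) (β t) m).eval x := by
  induction m using Nat.twoStepInduction with
  | zero => simpa [denPoly] using contDiff_const
  | one => simpa [denPoly] using contDiff_const.sub (hα 0)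
  | more k h1 h2 =>
    simp only [denPoly, eval_sub, eval_mul, eval_X, eval_C]
    exact ((contDiff_const.sub (hα _)).mul h2).sub (((hβ _).pow 2).mul h1)

theorem contDiff_eval_numPoly (hα : ∀ k, ContDiff ℝ ∞ fun t => α t k)
    (hβ : ∀ k, ContDiff ℝ ∞ fun t => β t k) (m : ℕ) (x : ℝ) :
    ContDiff ℝ ∞ fun t => (numPoly (α t) (β t) m).eval x := by
  cases m with
  | zero => simpa [numPoly] using contDiff_const
  | succ m =>
    simp only [numPoly_succ, eval_mul, eval_C]
    exact ((hβ 0).pow 2).mul (contDiff_eval_denPoly (fun k => hα (k + 1)) (fun k => hβ (k + 1)) m x)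

end eval

theorem contDiffOn_matrix {E : Type*} [NormedAddCommGroup E] [NormedSpace ℝ E]
    {O : Set E} {M : E → Matrix (Fin N) (Fin N) ℝ}
    (h : ∀ i j, ContDiffOn ℝ ∞ (fun t => M t i j) O) : ContDiffOn ℝ ∞ M O := by
  refine (contDiffOn_pi (F' := fun _ : Fin N => Fin N → ℝ)).2 fun i => ?_
  exact (contDiffOn_pi (F' := fun _ : Fin N => ℝ)).2 fun j => h i j

theorem contDiffOn_perturb {E : Type*} [NormedAddCommGroup E] [NormedSpace ℝ E]
    {O : Set E} {M : E → Matrix (Fin N) (Fin N) ℝ}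
    (h : ∀ i j, ContDiffOn ℝ ∞ (fun t => M t i j) O) (n : Fin N) (θ K : ℝ) :
    ContDiffOn ℝ ∞ (fun t => perturb n θ K (M t)) O := by
  refine contDiffOn_matrix fun i j => ?_
  simp only [perturb, Matrix.of_apply]
  split_ifs
  · exact contDiffOn_const.mul ((h n n).add contDiffOn_const)
  · exact contDiffOn_const.mul (h i j)
  · exact h i j

/-- The residues at the poles of the left half line: at a common pole `z ∈ W` the fraction given
by the parameter `t`, elsewhere everything. -/
def leftWeight (W : Finset ℝ) (η : ℝ → ℝ) (t : EuclideanSpace ℝ (Fin W.card)) (z : ℝ) : ℝ :=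
  if h : z ∈ W then t (W.equivFin ⟨z, h⟩) * η z else η z

/-- The residues at the poles of the right half line, complementary to `leftWeight` on `W`. -/
def rightWeight (W : Finset ℝ) (η : ℝ → ℝ) (t : EuclideanSpace ℝ (Fin W.card)) (z : ℝ) : ℝ :=
  if h : z ∈ W then (1 - t (W.equivFin ⟨z, h⟩)) * η z else η z

theorem contDiff_coeff_leftWeight (Y W : Finset ℝ) (η : ℝ → ℝ) (i : ℕ) :
    ContDiff ℝ ∞ fun t => (residuePoly Y (leftWeight W η t)).coeff i := by
  simp only [residuePoly, finsetSum_coeff, coeff_C_mul]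
  refine ContDiff.sum fun z _ => ContDiff.mul ?_ contDiff_const
  unfold leftWeight
  split_ifs
  · fun_prop
  · exact contDiff_const

theorem contDiff_coeff_rightWeight (Y W : Finset ℝ) (η : ℝ → ℝ) (i : ℕ) :
    ContDiff ℝ ∞ fun t => (residuePoly Y (rightWeight W η t)).coeff i := by
  simp only [residuePoly, finsetSum_coeff, coeff_C_mul]
  refine ContDiff.sum fun z _ => ContDiff.mul ?_ contDiff_const
  unfold rightWeight
  split_ifs
  · fun_prop
  · exact contDiff_const

theorem leftWeight_pos {W : Finset ℝ} {η : ℝ → ℝ} {t : EuclideanSpace ℝ (Fin W.card)}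
    (ht : t ∈ openBox W.card) {z : ℝ} (hz : 0 < η z) : 0 < leftWeight W η t z := by
  unfold leftWeight
  split_ifs
  · exact mul_pos (ht _).1 hz
  · exact hz

theorem rightWeight_pos {W : Finset ℝ} {η : ℝ → ℝ} {t : EuclideanSpace ℝ (Fin W.card)}
    (ht : t ∈ openBox W.card) {z : ℝ} (hz : 0 < η z) : 0 < rightWeight W η t z := by
  unfold rightWeight
  split_ifs
  · exact mul_pos (sub_pos.2 (ht _).2) hz
  · exact hz

namespace SplitData

variable {n : Fin N} {lam lamh : Fin N → ℝ} {K θ : ℝ} {Z W : Finset ℝ} {R : ℝ[X]} {a : ℝ}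

theorem mem_iff (h : SplitData n lam lamh K θ Z W R a)
    {P : Matrix (Fin N) (Fin N) ℝ × Matrix (Fin N) (Fin N) ℝ} :
    P ∈ inverseFamily n lam lamh K θ ↔ IsJacobi P.1 ∧ P.2 = perturb n θ K P.1 ∧
      P.1.charpoly = nod (pts lam) ∧ leftDen n P.1 * rightDen n P.1 = nod Z * nod W := by
  have e1 : Set.range lam = (pts lam : Set ℝ) := by simp [pts]
  have e2 : Set.range lamh = (pts lamh : Set ℝ) := by simp [pts]
  rw [inverseFamily, Set.mem_ofPred_eq, e1, e2, spectrum_eq_iff _ (card_pts h.mono),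
    spectrum_eq_iff _ (card_pts h.monoh)]
  have hne : C (1 - θ ^ 2) * (X - C K) ≠ 0 :=
    mul_ne_zero (C_ne_zero.2 (sub_pos.2 h.theta_lt).ne') (X_sub_C_ne_zero K)
  constructor
  · rintro ⟨h1, h2, h3, h4, h5⟩
    refine ⟨h1, h3, h4, ?_⟩
    rw [h3, IsJacobi.charpoly_perturb h1 n h.theta_pos, h.charh_eq, h4] at h5
    refine mul_left_cancel₀ hne ?_
    linear_combination h5
  · rintro ⟨h1, h2, h3, h4⟩
    refine ⟨h1, ?_, h2, h3, ?_⟩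
    · rw [h2]
      exact isJacobi_perturb h1 n h.theta_pos K
    · rw [h2, IsJacobi.charpoly_perturb h1 n h.theta_pos, h.charh_eq, h3, h4]

/-- The solutions for which exactly the points of `A ∪ W` are poles of the left half line. -/
def component (n : Fin N) (lam lamh : Fin N → ℝ) (K θ : ℝ) (W A : Finset ℝ) :
    Set (Matrix (Fin N) (Fin N) ℝ × Matrix (Fin N) (Fin N) ℝ) :=
  {P | P ∈ inverseFamily n lam lamh K θ ∧ leftDen n P.1 = nod (A ∪ W)}

theorem splits : (nod Z * nod W).Splits := by
  refine Splits.mul ?_ ?_ <;> exact Splits.prod fun z _ => Splits.X_sub_C z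

theorem exists_component (h : SplitData n lam lamh K θ Z W R a)
    {P : Matrix (Fin N) (Fin N) ℝ × Matrix (Fin N) (Fin N) ℝ}
    (hP : P ∈ inverseFamily n lam lamh K θ) :
    ∃ A ∈ Finset.powersetCard (n - W.card) (Z \ W), leftDen n P.1 = nod (A ∪ W) := by
  obtain ⟨hJ, -, -, hprod⟩ := h.mem_iff.1 hP
  have hne : nod Z * nod W ≠ 0 := mul_ne_zero (nod_ne_zero Z) (nod_ne_zero W)
  obtain ⟨ZL, hZL, hL, -⟩ := exists_posPair (fun k hk => (IsJacobi.left_neg hJ n.2 k hk).ne) hne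
    splits (hprod ▸ dvd_mul_right (leftDen n P.1) _)
  obtain ⟨ZR, hZR, hR, -⟩ := exists_posPair (fun k hk => (IsJacobi.right_neg hJ k hk).ne) hne
    splits (hprod ▸ dvd_mul_left (rightDen n P.1) _)
  change leftDen n P.1 = _ at hL
  change rightDen n P.1 = _ at hR
  rw [hL, hR] at hprod
  obtain ⟨h1, h2, h3⟩ := sdiff_of_nod_mul_eq h.subset hprod
  refine ⟨ZL \ W, Finset.mem_powersetCard.2 ⟨Finset.sdiff_subset_sdiff h2 le_rfl, ?_⟩, ?_⟩
  · rw [Finset.card_sdiff_of_subset h1, hZL]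
  · rw [hL, Finset.sdiff_union_of_subset h1]

section component

variable {A : Finset ℝ}

theorem card_union (h : SplitData n lam lamh K θ Z W R a)
    (hA : A ∈ Finset.powersetCard (n - W.card) (Z \ W)) : (A ∪ W).card = n := by
  obtain ⟨h1, h2⟩ := Finset.mem_powersetCard.1 hA
  have := h.card_le
  rw [Finset.card_union_of_disjoint (Finset.subset_sdiff.1 h1).2]
  omega

theorem card_sdiff (h : SplitData n lam lamh K θ Z W R a)
    (hA : A ∈ Finset.powersetCard (n - W.card) (Z \ W)) : (Z \ A).card = N - n - 1 := by
  obtain ⟨h1, h2⟩ := Finset.mem_powersetCard.1 hA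
  have := h.card_le
  have := h.card
  rw [Finset.card_sdiff_of_subset (Finset.subset_sdiff.1 h1).1]
  omega

theorem component_spec (h : SplitData n lam lamh K θ Z W R a)
    (hA : A ∈ Finset.powersetCard (n - W.card) (Z \ W))
    {P : Matrix (Fin N) (Fin N) ℝ × Matrix (Fin N) (Fin N) ℝ}
    (hP : P ∈ component n lam lamh K θ W A) :
    rightDen n P.1 = nod (Z \ A) ∧ PosPair (A ∪ W) (leftNum n P.1) ∧
      PosPair (Z \ A) (rightNum n P.1) ∧ P.1 n n = a ∧
      ∀ z ∈ Z, (if z ∈ A ∪ W then residue (A ∪ W) (leftNum n P.1) z else 0) +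
        (if z ∈ Z \ A then residue (Z \ A) (rightNum n P.1) z else 0) = residue Z R z := by
  obtain ⟨hPS, hL⟩ := hP
  obtain ⟨hJ, -, hchar, hprod⟩ := h.mem_iff.1 hPS
  have hAZ := (Finset.mem_powersetCard.1 hA).1
  have hne : nod Z * nod W ≠ 0 := mul_ne_zero (nod_ne_zero Z) (nod_ne_zero W)
  obtain ⟨ZL, -, hL', hpL⟩ := exists_posPair (fun k hk => (IsJacobi.left_neg hJ n.2 k hk).ne) hne
    splits (hprod ▸ dvd_mul_right (leftDen n P.1) _)
  obtain ⟨ZR, -, hR', hpR⟩ := exists_posPair (fun k hk => (IsJacobi.right_neg hJ k hk).ne) hne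
    splits (hprod ▸ dvd_mul_left (rightDen n P.1) _)
  have hR : rightDen n P.1 = nod (Z \ A) := by
    rw [hL, ← nod_mul_nod_of_subset hAZ] at hprod
    exact mul_left_cancel₀ (nod_ne_zero _) hprod
  obtain rfl : ZL = A ∪ W := nod_injective (hL'.symm.trans hL)
  obtain rfl : ZR = Z \ A := nod_injective (hR'.symm.trans hR)
  rw [IsJacobi.charpoly_eq hJ n, h.char_eq, hL, hR] at hchar
  have := (split_iff h.subset hAZ h.posPair.1 hpL.1 hpR.1).1 hchar
  exact ⟨hR, hpL, hpR, this⟩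

/-- The splitting fractions of the residues at the common poles are smooth coordinates on a
component. -/
theorem isBallManifold (h : SplitData n lam lamh K θ Z W R a)
    (hA : A ∈ Finset.powersetCard (n - W.card) (Z \ W)) :
    IsBallManifold W.card (component n lam lamh K θ W A) := by
  have hAZ := (Finset.mem_powersetCard.1 hA).1
  have hη : ∀ z ∈ Z, 0 < residue Z R z := fun z hz => h.posPair.residue_pos hz
  have hsub : A ∪ W ⊆ Z := Finset.union_subset (Finset.subset_sdiff.1 hAZ).1 h.subset
  have hWA : ∀ z ∈ W, z ∉ A := fun z hz hzA =>
    Finset.disjoint_left.1 (Finset.subset_sdiff.1 hAZ).2 hzA hz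
  have hposL : ∀ t ∈ openBox W.card,
      PosPair (A ∪ W) (residuePoly (A ∪ W) (leftWeight W (residue Z R) t)) := fun t ht =>
    posPair_residuePoly fun z hz => leftWeight_pos ht (hη z (hsub hz))
  have hposR : ∀ t ∈ openBox W.card,
      PosPair (Z \ A) (residuePoly (Z \ A) (rightWeight W (residue Z R) t)) := fun t ht =>
    posPair_residuePoly fun z hz => rightWeight_pos ht (hη z (Finset.mem_sdiff.1 hz).1)
  obtain ⟨αL, βL, hαL, hβL, hL⟩ := exists_smooth_halfLine (O := openBox W.card) n
    (D := fun _ => nod (A ∪ W))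
    (B := fun t => residuePoly (A ∪ W) (leftWeight W (residue Z R) t))
    (fun i => contDiffOn_const) (fun i => (contDiff_coeff_leftWeight _ _ _ i).contDiffOn)
    (fun t ht => ⟨A ∪ W, h.card_union hA, rfl, hposL t ht⟩)
  obtain ⟨αR, βR, hαR, hβR, hR⟩ := exists_smooth_halfLine (O := openBox W.card) (N - n - 1)
    (D := fun _ => nod (Z \ A))
    (B := fun t => residuePoly (Z \ A) (rightWeight W (residue Z R) t))
    (fun i => contDiffOn_const) (fun i => (contDiff_coeff_rightWeight _ _ _ i).contDiffOn)
    (fun t ht => ⟨Z \ A, h.card_sdiff hA, rfl, hposR t ht⟩)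
  set J : EuclideanSpace ℝ (Fin W.card) → Matrix (Fin N) (Fin N) ℝ := fun t =>
    glueJac N n (αL t) (βL t) a (αR t) (βR t) with hJdef
  have hJ : ∀ t ∈ openBox W.card, IsJacobi (J t) := fun t ht =>
    isJacobi_glueJac (hL t ht).1 (hR t ht).1
  have hJn : ∀ t, J t n n = a := fun t => glueJac_apply n
  have hLD : ∀ t ∈ openBox W.card, leftDen n (J t) = nod (A ∪ W) := fun t ht =>
    (leftDen_glueJac n.2).trans (hL t ht).2.1
  have hLN : ∀ t ∈ openBox W.card, leftNum n (J t) =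
      residuePoly (A ∪ W) (leftWeight W (residue Z R) t) := fun t ht =>
    (leftNum_glueJac n.2).trans (hL t ht).2.2
  have hRD : ∀ t ∈ openBox W.card, rightDen n (J t) = nod (Z \ A) := fun t ht =>
    rightDen_glueJac.trans (hR t ht).2.1
  have hRN : ∀ t ∈ openBox W.card, rightNum n (J t) =
      residuePoly (Z \ A) (rightWeight W (residue Z R) t) := fun t ht =>
    rightNum_glueJac.trans (hR t ht).2.2
  have hJs : ∀ i j, ContDiffOn ℝ ∞ (fun t => J t i j) (openBox W.card) := fun i j => by
    simp only [hJdef, glueJac, jac, Matrix.of_apply]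
    split_ifs <;> first | exact hαL _ | exact hβL _ | exact hαR _ | exact hβR _ |
      exact contDiffOn_const
  let ψ : Matrix (Fin N) (Fin N) ℝ × Matrix (Fin N) (Fin N) ℝ → EuclideanSpace ℝ (Fin W.card) :=
    fun P => WithLp.toLp 2 fun i => residue (A ∪ W) (leftNum n P.1) (W.equivFin.symm i) /
      residue Z R (W.equivFin.symm i)
  have hψ : ∀ P ∈ component n lam lamh K θ W A, ψ P ∈ openBox W.card := by
    intro P hP i
    obtain ⟨-, hpL, hpR, -, hsum⟩ := h.component_spec hA hP
    have hzW : (W.equivFin.symm i : ℝ) ∈ W := (W.equivFin.symm i).2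
    have h1 : (W.equivFin.symm i : ℝ) ∈ A ∪ W := Finset.mem_union_right _ hzW
    have h2 : (W.equivFin.symm i : ℝ) ∈ Z \ A :=
      Finset.mem_sdiff.2 ⟨h.subset hzW, hWA _ hzW⟩
    have h3 := hsum _ (h.subset hzW)
    rw [if_pos h1, if_pos h2] at h3
    have h4 := hpL.residue_pos h1
    have h5 := hpR.residue_pos h2
    have h6 := hη _ (h.subset hzW)
    exact ⟨div_pos h4 h6, (div_lt_one h6).2 (by linarith)⟩
  refine isBallManifold_of_openBox (φ := fun t => (J t, perturb n θ K (J t)))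
    (ψ := ψ)
    ((contDiffOn_matrix hJs).prodMk (contDiffOn_perturb hJs n θ K)) ?_ ?_ ?_ ⟨?_, ?_⟩
  · rw [contDiff_euclidean]
    intro i
    simp only [ψ, residue, leftNum]
    exact ((contDiff_eval_numPoly (fun k => contDiff_diagSeq _) (fun k => contDiff_offSeq _) _
      _).div_const _).div_const _
  · intro t ht
    refine ⟨h.mem_iff.2 ⟨hJ t ht, rfl, ?_, ?_⟩, hLD t ht⟩
    · simp only
      rw [IsJacobi.charpoly_eq (hJ t ht) n, h.char_eq, hLD t ht, hRD t ht, hLN t ht, hRN t ht]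
      refine (split_iff h.subset hAZ h.posPair.1 (hposL t ht).1 (hposR t ht).1).2
        ⟨hJn t, fun z hz => ?_⟩
      by_cases hzW : z ∈ W
      · have h1 : z ∈ A ∪ W := Finset.mem_union_right _ hzW
        have h2 : z ∈ Z \ A := Finset.mem_sdiff.2 ⟨hz, hWA z hzW⟩
        rw [if_pos h1, if_pos h2, residue_residuePoly _ h1, residue_residuePoly _ h2,
          leftWeight, rightWeight, dif_pos hzW, dif_pos hzW]
        ring
      · by_cases hzA : z ∈ A
        · have h1 : z ∈ A ∪ W := Finset.mem_union_left _ hzA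
          have h2 : z ∉ Z \ A := fun h2 => (Finset.mem_sdiff.1 h2).2 hzA
          rw [if_pos h1, if_neg h2, residue_residuePoly _ h1, leftWeight, dif_neg hzW, add_zero]
        · have h1 : z ∉ A ∪ W := fun h1 => (Finset.mem_union.1 h1).elim hzA hzW
          have h2 : z ∈ Z \ A := Finset.mem_sdiff.2 ⟨hz, hzA⟩
          rw [if_neg h1, if_pos h2, residue_residuePoly _ h2, rightWeight, dif_neg hzW, zero_add]
    · simp only
      rw [hLD t ht, hRD t ht, nod_mul_nod_of_subset hAZ]
  · exact hψ
  · intro t ht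
    ext i
    have hzW : (W.equivFin.symm i : ℝ) ∈ W := (W.equivFin.symm i).2
    simp only [ψ]
    rw [hLN t ht, residue_residuePoly _ (Finset.mem_union_right _ hzW), leftWeight, dif_pos hzW,
      mul_div_cancel_right₀ _ (hη _ (h.subset hzW)).ne']
    simp
  · intro P hP
    obtain ⟨hPR, hpL, hpR, hPn, hsum⟩ := h.component_spec hA hP
    obtain ⟨hPJ, hP2, -, -⟩ := h.mem_iff.1 hP.1
    set t := ψ P with htdef
    have ht : t ∈ openBox W.card := hψ P hP
    have htz : ∀ z (hz : z ∈ W), t (W.equivFin ⟨z, hz⟩) * residue Z R z =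
        residue (A ∪ W) (leftNum n P.1) z := fun z hz => by
      simp only [htdef, ψ, Equiv.symm_apply_apply]
      exact div_mul_cancel₀ _ (hη z (h.subset hz)).ne'
    have hJP : J t = P.1 := by
      refine IsJacobi.ext (hJ t ht) hPJ n ((hJn t).trans hPn.symm) ((hLD t ht).trans hP.2.symm)
        ?_ ((hRD t ht).trans hPR.symm) ?_
      · rw [hLN t ht, eq_residuePoly_residue hpL.1]
        refine residuePoly_congr fun z hz => ?_
        rw [leftWeight]
        split_ifs with hzW
        · exact htz z hzW
        · have h2 : z ∉ Z \ A := fun h2 =>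
            (Finset.mem_sdiff.1 h2).2 ((Finset.mem_union.1 hz).resolve_right hzW)
          have h3 := hsum z (hsub hz)
          rw [if_pos hz, if_neg h2, add_zero] at h3
          exact h3.symm
      · rw [hRN t ht, eq_residuePoly_residue hpR.1]
        refine residuePoly_congr fun z hz => ?_
        rw [rightWeight]
        have h3 := hsum z (Finset.mem_sdiff.1 hz).1
        split_ifs with hzW
        · rw [if_pos (Finset.mem_union_right _ hzW), if_pos hz] at h3
          have := htz z hzW
          linarith
        · have h1 : z ∉ A ∪ W := fun h1 =>
            (Finset.mem_union.1 h1).elim (Finset.mem_sdiff.1 hz).2 hzW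
          rw [if_neg h1, if_pos hz, zero_add] at h3
          exact h3.symm
    exact Prod.ext hJP (by simp only; rw [hJP, hP2])

/-- On the inverse spectral family a component is cut out by finitely many inequalities. -/
theorem exists_isOpen_component (h : SplitData n lam lamh K θ Z W R a)
    (hA : A ∈ Finset.powersetCard (n - W.card) (Z \ W)) :
    ∃ U : Set (Matrix (Fin N) (Fin N) ℝ × Matrix (Fin N) (Fin N) ℝ), IsOpen U ∧
      component n lam lamh K θ W A = inverseFamily n lam lamh K θ ∩ U := by
  refine ⟨⋂ z ∈ Z \ (A ∪ W), {P | (leftDen n P.1).eval z ≠ 0}, ?_, ?_⟩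
  · refine isOpen_biInter_finset fun z _ => isOpen_ne_fun ?_ continuous_const
    exact (contDiff_eval_denPoly (fun k => contDiff_diagSeq _) (fun k => contDiff_offSeq _) _
      _).continuous
  · ext P
    simp only [component, Set.mem_ofPred_eq, Set.mem_inter_iff, Set.mem_iInter]
    refine and_congr_right fun hP => ⟨fun hL z hz h0 => ?_, fun hz => ?_⟩
    · rw [hL, eval_nod_eq_zero] at h0
      exact (Finset.mem_sdiff.1 hz).2 h0
    · obtain ⟨A', hA', hL⟩ := h.exists_component hP
      rw [hL]
      congr 1
      refine Finset.eq_of_subset_of_card_le (fun x hx => ?_)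
        (by rw [h.card_union hA, h.card_union hA'])
      by_contra hxA
      refine hz x (Finset.mem_sdiff.2 ⟨?_, hxA⟩) ?_
      · rcases Finset.mem_union.1 hx with hx | hx
        · exact (Finset.mem_sdiff.1 ((Finset.mem_powersetCard.1 hA').1 hx)).1
        · exact h.subset hx
      · rw [hL, eval_nod_eq_zero]
        exact hx

end component

theorem isDisjointUnionOfBalls (h : SplitData n lam lamh K θ Z W R a) :
    IsDisjointUnionOfBalls ((N - 2 * W.card - 1).choose (n.val - W.card)) W.card
      (inverseFamily n lam lamh K θ) := by
  have hcard : (Finset.powersetCard (n - W.card) (Z \ W)).card =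
      (N - 2 * W.card - 1).choose (n.val - W.card) := by
    have := h.card
    rw [Finset.card_powersetCard, Finset.card_sdiff_of_subset h.subset]
    congr 1
    omega
  rw [← hcard]
  let e := (Finset.powersetCard (n - W.card) (Z \ W)).equivFin
  refine ⟨fun i => component n lam lamh K θ W (e.symm i).1, fun i j hij => ?_, ?_, fun i =>
    ⟨h.exists_isOpen_component (e.symm i).2, h.isBallManifold (e.symm i).2⟩⟩
  · refine Set.disjoint_left.2 fun P hi hj => hij ?_
    have h1 := nod_injective (hi.2.symm.trans hj.2)
    have h2 : ∀ i, (e.symm i).1 = ((e.symm i).1 ∪ W) \ W := fun i =>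
      (Finset.union_sdiff_cancel_right
        (Finset.subset_sdiff.1 (Finset.mem_powersetCard.1 (e.symm i).2).1).2).symm
    exact e.symm.injective (Subtype.ext (by rw [h2 i, h2 j, h1]))
  · ext P
    simp only [Set.mem_iUnion]
    constructor
    · rintro ⟨i, hi⟩
      exact hi.1
    · intro hP
      obtain ⟨A, hA, hL⟩ := h.exists_component hP
      refine ⟨e ⟨A, hA⟩, hP, ?_⟩
      rw [e.symm_apply_apply]
      exact hL

end SplitData

/-! ### Consequences of interlacing -/

variable {n : Fin N} {lam lamh : Fin N → ℝ} {K θ : ℝ}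

/-- The `N` intervals of the interlacing condition are disjoint and ordered, so the `i`-th of them
contains the `i`-th point of `σ̂`. -/
theorem exists_index_bounds (hlam : StrictMono lam) (hlamh : StrictMono lamh)
    (hI : Interlace lam lamh K) (hK : K ∈ pts lam → K ∈ pts lamh) :
    ∃ p : ℕ, (∀ i : Fin N, lam i < K ↔ i.val < p) ∧ ∀ i : Fin N,
      (i.val < p → lam i ≤ lamh i ∧ lamh i < K ∧
        ∀ j : Fin N, i.val + 1 = j.val → j.val < p → lamh i < lam j) ∧
      (p ≤ i.val → lamh i ≤ lam i ∧ K ≤ lamh i ∧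
        ∀ j : Fin N, j.val + 1 = i.val → p ≤ j.val → lam j < lamh i) := by
  obtain ⟨p, hpN, hp, h1, h2, h3, h4⟩ := hI
  refine ⟨p, hp, ?_⟩
  have hex : ∀ i : Fin N, ∃ k : Fin N,
      (i.val < p → lam i ≤ lamh k ∧ lamh k < K ∧
        ∀ j : Fin N, i.val + 1 = j.val → j.val < p → lamh k < lam j) ∧
      (p ≤ i.val → lamh k ≤ lam i ∧ K ≤ lamh k ∧
        ∀ j : Fin N, j.val + 1 = i.val → p ≤ j.val → lam j < lamh k) := by
    intro i
    rcases lt_or_ge i.val p with hi | hi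
    · rcases (show i.val + 1 ≤ p from hi).eq_or_lt with hi1 | hi1
      · obtain ⟨k, hk, -⟩ := h3 i hi1
        exact ⟨k, fun _ => ⟨hk.1, hk.2, fun j hj hjp => by omega⟩, fun h => by omega⟩
      · have hN : i.val + 1 < N := by omega
        obtain ⟨k, hk, -⟩ := h1 i ⟨i.val + 1, hN⟩ rfl hi1
        refine ⟨k, fun _ => ⟨hk.1, hk.2.trans ((hp _).2 hi1), fun j hj _ => ?_⟩,
          fun h => by omega⟩
        have : (⟨i.val + 1, hN⟩ : Fin N) = j := Fin.ext hj
        exact this ▸ hk.2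
    · have hKi : K ≤ lam i := not_lt.1 fun h => by have := (hp i).1 h; omega
      rcases hi.eq_or_lt with hi1 | hi1
      · -- If `K = λ_p`, the interval `(K, λ_p]` is empty and the point `K` of `σ̂` takes its place.
        rcases hKi.eq_or_lt with hK1 | hK1
        · have : K ∈ pts lamh := hK <| by
            rw [hK1]; exact Finset.mem_image_of_mem _ (Finset.mem_univ i)
          obtain ⟨k, -, hk⟩ := Finset.mem_image.1 this
          exact ⟨k, fun h => by omega, fun _ => ⟨by rw [hk]; exact hKi, hk.ge,
            fun j hj hjp => by omega⟩⟩
        · obtain ⟨k, hk, -⟩ := h4 i hi1.symm hK1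
          exact ⟨k, fun h => by omega, fun _ => ⟨hk.2, hk.1.le, fun j hj hjp => by omega⟩⟩
      · have hlt : i.val - 1 < N := by omega
        obtain ⟨k, hk, -⟩ := h2 ⟨i.val - 1, hlt⟩ i (by simp only; omega) (by simp only; omega)
        have hKj : K ≤ lam ⟨i.val - 1, hlt⟩ := not_lt.1 fun h => by
          have := (hp _).1 h
          simp only at this
          omega
        refine ⟨k, fun h => by omega, fun _ => ⟨hk.2, hKj.trans hk.1.le, fun j hj _ => ?_⟩⟩
        have : (⟨i.val - 1, hlt⟩ : Fin N) = j := Fin.ext (by simp only; omega)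
        exact this ▸ hk.1
  choose f hf1 hf2 using hex
  have hf : StrictMono f := by
    intro i j hij
    rw [← hlamh.lt_iff_lt]
    have hij' : i.val < j.val := hij
    rcases lt_or_ge j.val p with hj | hj
    · have hN : i.val + 1 < N := by omega
      have hle : (⟨i.val + 1, hN⟩ : Fin N) ≤ j := hij'
      exact (((hf1 i (by omega)).2.2 ⟨i.val + 1, hN⟩ rfl (by simp only; omega)).trans_le
        (hlam.monotone hle)).trans_le (hf1 j hj).1
    · rcases lt_or_ge i.val p with hi | hi
      · exact (hf1 i hi).2.1.trans_le (hf2 j hj).2.1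
      · have hN : j.val - 1 < N := by omega
        have hle : i ≤ (⟨j.val - 1, hN⟩ : Fin N) := by
          rw [Fin.le_def]; simp only; omega
        exact ((hf2 i hi).1.trans (hlam.monotone hle)).trans_lt
          ((hf2 j hj).2.2 ⟨j.val - 1, hN⟩ (by simp only; omega) (by simp only; omega))
  have hid : f = id := hf.eq_id
  subst hid
  exact fun i => ⟨hf1 i, hf2 i⟩

/-- Interlacing fixes the sign of the residue of `∏ (x - λ̂_j) / ∏ (x - λ_j)` at a point of `σ`
according to the side of `K` on which it lies. -/
theorem interlace_sign (hlam : StrictMono lam) (hlamh : StrictMono lamh)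
    (hI : Interlace lam lamh K) (hK : K ∈ pts lam → K ∈ pts lamh) {y : ℝ}
    (hy : y ∈ pts lam \ pts lamh) :
    0 < (nod (pts lamh)).eval y * (nod ((pts lam).erase y)).eval y * (y - K) := by
  obtain ⟨p, hp, hb⟩ := exists_index_bounds hlam hlamh hI hK
  obtain ⟨hy1, hy2⟩ := Finset.mem_sdiff.1 hy
  obtain ⟨i, -, rfl⟩ := Finset.mem_image.1 hy1
  have hyK : lam i ≠ K := fun h => hy2 (by rw [h]; exact hK (h ▸ hy1))
  have hne : lamh i ≠ lam i := fun h => hy2 (by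
    rw [← h]; exact Finset.mem_image_of_mem _ (Finset.mem_univ i))
  have e1 : (nod (pts lamh)).eval (lam i) =
      (lam i - lamh i) * ∏ j ∈ Finset.univ.erase i, (lam i - lamh j) := by
    rw [eval_nod, pts, Finset.prod_image hlamh.injective.injOn,
      Finset.mul_prod_erase _ (fun j => lam i - lamh j) (Finset.mem_univ i)]
  have e2 : (nod ((pts lam).erase (lam i))).eval (lam i) =
      ∏ j ∈ Finset.univ.erase i, (lam i - lam j) := by
    rw [eval_nod, pts, ← Finset.image_erase hlam.injective,
      Finset.prod_image hlam.injective.injOn]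
  have e3 : 0 < (lam i - lamh i) * (lam i - K) := by
    rcases lt_or_ge i.val p with hi | hi
    · have h1 := lt_of_le_of_ne ((hb i).1 hi).1 hne.symm
      have h2 := (hp i).2 hi
      exact mul_pos_of_neg_of_neg (by linarith) (by linarith)
    · have h1 := lt_of_le_of_ne ((hb i).2 hi).1 hne
      have h2 : K < lam i := lt_of_le_of_ne
        (not_lt.1 fun h => by have := (hp i).1 h; omega) hyK.symm
      exact mul_pos (by linarith) (by linarith)
  have e4 : 0 < ∏ j ∈ Finset.univ.erase i, ((lam i - lamh j) * (lam i - lam j)) := by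
    refine Finset.prod_pos fun j hj => ?_
    rcases lt_or_gt_of_ne (Finset.ne_of_mem_erase hj) with hji | hji
    · have hji' : j.val < i.val := hji
      have h1 := hlam hji
      have h2 : lamh j < lam i := by
        rcases lt_or_ge j.val p with hjp | hjp
        · rcases lt_or_ge i.val p with hi | hi
          · have hN : j.val + 1 < N := by omega
            have hle : (⟨j.val + 1, hN⟩ : Fin N) ≤ i := hji'
            exact (((hb j).1 hjp).2.2 ⟨j.val + 1, hN⟩ rfl (by simp only; omega)).trans_le
              (hlam.monotone hle)
          · exact ((hb j).1 hjp).2.1.trans_le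
              (not_lt.1 fun h => by have := (hp i).1 h; omega)
        · exact ((hb j).2 hjp).1.trans_lt h1
      exact mul_pos (by linarith) (by linarith)
    · have hji' : i.val < j.val := hji
      have h1 := hlam hji
      have h2 : lam i < lamh j := by
        rcases lt_or_ge j.val p with hjp | hjp
        · exact h1.trans_le ((hb j).1 hjp).1
        · rcases lt_or_ge i.val p with hi | hi
          · exact ((hp i).2 hi).trans_le ((hb j).2 hjp).2.1
          · have hN : j.val - 1 < N := by omega
            have hle : i ≤ (⟨j.val - 1, hN⟩ : Fin N) := by
              rw [Fin.le_def]; simp only; omega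
            exact (hlam.monotone hle).trans_lt
              (((hb j).2 hjp).2.2 ⟨j.val - 1, hN⟩ (by simp only; omega) (by simp only; omega))
      exact mul_pos_of_neg_of_neg (by linarith) (by linarith)
  rw [Finset.prod_mul_distrib] at e4
  rw [e1, e2]
  nlinarith [mul_pos e3 e4]

/-- The sign of `interlace_sign` after cancelling the common points of `σ` and `σ̂`. -/
theorem interlace_sign_sdiff (hlam : StrictMono lam) (hlamh : StrictMono lamh)
    (hI : Interlace lam lamh K) (hK : K ∈ pts lam → K ∈ pts lamh) {y : ℝ}
    (hy : y ∈ pts lam \ pts lamh) :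
    0 < (nod (pts lamh \ pts lam)).eval y * (nod ((pts lam \ pts lamh).erase y)).eval y *
      (y - K) := by
  have h := interlace_sign hlam hlamh hI hK hy
  have e1 : nod (pts lamh) = nod (pts lam ∩ pts lamh) * nod (pts lamh \ pts lam) := by
    rw [← nod_union, Finset.inter_comm, Finset.union_comm, Finset.sdiff_union_inter]
    exact (Finset.disjoint_sdiff.mono_left Finset.inter_subset_left)
  have e2 : nod ((pts lam).erase y) =
      nod (pts lam ∩ pts lamh) * nod ((pts lam \ pts lamh).erase y) := by
    rw [← nod_union]
    · congr 1
      ext x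
      obtain ⟨hy1, hy2⟩ := Finset.mem_sdiff.1 hy
      simp only [Finset.mem_erase, Finset.mem_union, Finset.mem_inter, Finset.mem_sdiff]
      constructor
      · rintro ⟨h1, h2⟩
        by_cases h3 : x ∈ pts lamh
        · exact Or.inl ⟨h2, h3⟩
        · exact Or.inr ⟨h1, h2, h3⟩
      · rintro (⟨h1, h2⟩ | ⟨h1, h2, h3⟩)
        · exact ⟨fun h3 => hy2 (h3 ▸ h2), h1⟩
        · exact ⟨h1, h2⟩
    · exact (Finset.disjoint_sdiff.mono_left Finset.inter_subset_right).mono_right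
        (Finset.erase_subset _ _)
  rw [e1, e2, eval_mul, eval_mul] at h
  have h2 : 0 < (nod (pts lam ∩ pts lamh)).eval y ^ 2 *
      ((nod (pts lamh \ pts lam)).eval y * (nod ((pts lam \ pts lamh).erase y)).eval y *
      (y - K)) := by
    linarith
  exact pos_of_mul_pos_right h2 (sq_nonneg _)

/-! ### From the spectral data to the construction -/

theorem exists_splitData (hlam : StrictMono lam) (hlamh : StrictMono lamh) (hθ : 0 < θ)
    (hθ1 : θ ^ 2 < 1) {Y W : Finset ℝ} {B : ℝ[X]} (hYW : Disjoint W Y) (hU : W ∪ Y = pts lam)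
    (hW : W.card ≤ n) (hB : PosPair Y B) (hB1 : B.coeff (Y.card - 1) = 1)
    (hB0 : ∀ w ∈ W, B.eval w = 0)
    (hchar : nod (pts lamh) = C (θ ^ 2) * nod (pts lam) +
      C (1 - θ ^ 2) * ((X - C K) * (B * nod W))) :
    ∃ Z R a, SplitData n lam lamh K θ Z W R a := by
  have hcard : W.card + Y.card = N := by
    rw [← Finset.card_union_of_disjoint hYW, hU, card_pts hlam]
  obtain ⟨m, hm⟩ : ∃ m, Y.card = m + 1 := ⟨Y.card - 1, by omega⟩
  obtain ⟨Z, hZ, hBZ, hpos⟩ := hB.step hm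
  rw [hm, Nat.add_sub_cancel] at hB1
  rw [hB1, C_1, one_mul] at hBZ
  refine ⟨Z, _, (X * nod Z).coeff m - (nod Y).coeff m, hlam, hlamh, hθ, hθ1,
    fun w hw => ?_, by omega, hW, hpos, ?_, ?_⟩
  · rw [← eval_nod_eq_zero, ← hBZ]
    exact hB0 w hw
  · rw [← hU, nod_union hYW]
    ring
  · rw [hchar, hBZ]

theorem nod_pts_eq (lam lamh : Fin N → ℝ) :
    nod (pts lam) = nod (pts lam ∩ pts lamh) * nod (pts lam \ pts lamh) := by
  rw [← nod_union (Finset.disjoint_sdiff.mono_left Finset.inter_subset_right), Finset.union_comm,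
    Finset.sdiff_union_inter]

/-- `N̂ - θ²` multiplied by the reduced denominator of `N̂`. -/
def reducedNum (lam lamh : Fin N → ℝ) (θ : ℝ) : ℝ[X] :=
  nod (pts lamh \ pts lam) - C (θ ^ 2) * nod (pts lam \ pts lamh)

theorem Nhat_eq (x : ℝ) : Nhat lam lamh x =
    (nod (pts lamh \ pts lam)).eval x / (nod (pts lam \ pts lamh)).eval x := by
  rw [Nhat, eval_nod, eval_nod]

theorem eval_reducedNum {x : ℝ} (hx : x ∉ pts lam \ pts lamh) :
    (reducedNum lam lamh θ).eval x =
      (Nhat lam lamh x - θ ^ 2) * (nod (pts lam \ pts lamh)).eval x := by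
  have : (nod (pts lam \ pts lamh)).eval x ≠ 0 := fun h => hx (eval_nod_eq_zero.1 h)
  rw [Nhat_eq, reducedNum, sub_mul, div_mul_cancel₀ _ this]
  simp

theorem nod_pts_eq_reducedNum (lam lamh : Fin N → ℝ) (θ : ℝ) :
    nod (pts lamh) = C (θ ^ 2) * nod (pts lam) +
      nod (pts lam ∩ pts lamh) * reducedNum lam lamh θ := by
  rw [nod_pts_eq lam lamh, nod_pts_eq lamh lam, Finset.inter_comm (pts lamh), reducedNum]
  ring

theorem reducedNum_degree_coeff (hlam : StrictMono lam) (hlamh : StrictMono lamh) :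
    (reducedNum lam lamh θ).degree < ((pts lam \ pts lamh).card + 1 : ℕ) ∧
      (reducedNum lam lamh θ).coeff (pts lam \ pts lamh).card = 1 - θ ^ 2 := by
  have hc : (pts lamh \ pts lam).card = (pts lam \ pts lamh).card :=
    Finset.card_sdiff_comm ((card_pts hlamh).trans (card_pts hlam).symm)
  constructor
  · refine (degree_sub_le _ _).trans_lt (max_lt ?_ ?_)
    · rw [degree_nod, hc]
      exact_mod_cast Nat.lt_succ_self _
    · rw [← smul_eq_C_mul]
      refine (degree_smul_le _ _).trans_lt ?_
      rw [degree_nod]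
      exact_mod_cast Nat.lt_succ_self _
  · have h1 := (nod_monic (pts lamh \ pts lam)).coeff_natDegree
    have h2 := (nod_monic (pts lam \ pts lamh)).coeff_natDegree
    rw [natDegree_nod] at h1 h2
    rw [hc] at h1
    rw [reducedNum, coeff_sub, coeff_C_mul, h1, h2, mul_one]

/-- If `K` is a pole of the resolvent entry, the double zeros are the points `μ_1, …, μ_q`. -/
theorem exists_splitData_of_caseA (hlam : StrictMono lam) (hlamh : StrictMono lamh)
    (h : SpectralConditions n lam lamh K θ) (hK : K ∈ pts lam ∩ pts lamh)
    (hA : CaseA n lam lamh K θ) :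
    ∃ Z R a, SplitData n lam lamh K θ Z (commonPts lam lamh K) R a := by
  obtain ⟨hK1, hK2⟩ := Finset.mem_inter.1 hK
  have hKY : K ∉ pts lam \ pts lamh := fun h => (Finset.mem_sdiff.1 h).2 hK2
  have hpos : 0 < 1 - θ ^ 2 := sub_pos.2 h.cond_common.2
  obtain ⟨hdeg, hcoeff⟩ := reducedNum_degree_coeff (θ := θ) hlam hlamh
  refine exists_splitData (Y := insert K (pts lam \ pts lamh))
    (B := C (1 - θ ^ 2)⁻¹ * reducedNum lam lamh θ) hlam hlamh h.theta_pos
    h.cond_common.2 ?_ ?_ (hA.1.trans (min_le_left _ _)) ⟨?_, ?_⟩ ?_ ?_ ?_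
  · rw [commonPts, Finset.disjoint_insert_right]
    refine ⟨Finset.notMem_erase _ _, ?_⟩
    exact (Finset.disjoint_sdiff.mono_left Finset.inter_subset_right).mono_left
      (Finset.erase_subset _ _)
  · rw [commonPts, Finset.union_insert, ← Finset.insert_union, Finset.insert_erase hK,
      Finset.union_comm, Finset.sdiff_union_inter]
  · rw [Finset.card_insert_of_notMem hKY, ← smul_eq_C_mul]
    exact (degree_smul_le _ _).trans_lt hdeg
  · intro y hy
    rw [eval_mul, eval_C, mul_assoc]
    refine mul_pos (inv_pos.2 hpos) ?_
    rcases Finset.mem_insert.1 hy with rfl | hy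
    · rw [Finset.erase_insert hKY, eval_reducedNum hKY, mul_assoc]
      exact mul_pos (sub_pos.2 hA.2)
        (mul_self_pos.2 fun h0 => hKY (eval_nod_eq_zero.1 h0))
    · have hyK : y ≠ K := fun h => hKY (h ▸ hy)
      rw [Finset.erase_insert_of_ne hyK.symm,
        nod_insert fun h => hKY (Finset.mem_of_mem_erase h), reducedNum]
      have := interlace_sign_sdiff hlam hlamh h.interlace (fun _ => hK2) hy
      simp only [eval_sub, eval_mul, eval_C, eval_X, eval_nod_eq_zero.2 hy]
      linarith
  · rw [Finset.card_insert_of_notMem hKY, Nat.add_sub_cancel, coeff_C_mul, hcoeff,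
      inv_mul_cancel₀ hpos.ne']
  · intro w hw
    have hwY : w ∉ pts lam \ pts lamh := fun h => (Finset.mem_sdiff.1 h).2
      (Finset.mem_inter.1 (Finset.mem_of_mem_erase hw)).2
    rw [eval_mul, eval_reducedNum hwY, h.cond_common.1 w hw]
    ring
  · have e : C (1 - θ ^ 2) * C (1 - θ ^ 2)⁻¹ = (1 : ℝ[X]) := by
      rw [← C_mul, mul_inv_cancel₀ hpos.ne', C_1]
    rw [nod_pts_eq_reducedNum lam lamh θ, nod_erase hK, commonPts]
    linear_combination (-((X - C K) * nod ((pts lam ∩ pts lamh).erase K) *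
      reducedNum lam lamh θ)) * e

/-- If `K` is not a pole of the resolvent entry, the double zeros are the points of `σ ∩ σ̂`. -/
theorem exists_splitData_of_Nhat_eq (hlam : StrictMono lam) (hlamh : StrictMono lamh)
    (h : SpectralConditions n lam lamh K θ) (hK : K ∉ pts lam \ pts lamh)
    (hNK : Nhat lam lamh K = θ ^ 2) (hcard : (pts lam ∩ pts lamh).card ≤ n)
    (hder : K ∈ pts lam ∩ pts lamh → deriv (Nhat lam lamh) K = 0) :
    ∃ Z R a, SplitData n lam lamh K θ Z (pts lam ∩ pts lamh) R a := by
  have hpos : 0 < 1 - θ ^ 2 := sub_pos.2 h.cond_common.2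
  obtain ⟨hdeg, hcoeff⟩ := reducedNum_degree_coeff (θ := θ) hlam hlamh
  obtain ⟨V, hV⟩ : X - C K ∣ reducedNum lam lamh θ := dvd_iff_isRoot.2 (by
    rw [IsRoot.def, eval_reducedNum hK, hNK, sub_self, zero_mul])
  have hcard' : (pts lam \ pts lamh).card ≠ 0 := by
    have h1 := Finset.card_sdiff_add_card_inter (pts lam) (pts lamh)
    rw [card_pts hlam] at h1
    have := n.2
    omega
  obtain ⟨m, hm⟩ := Nat.exists_eq_succ_of_ne_zero hcard'
  rw [hm, Nat.succ_eq_add_one] at hdeg hcoeff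
  have hVdeg : V.degree < (m + 1 : ℕ) := by
    rw [hV, degree_mul, degree_X_sub_C] at hdeg
    by_cases hV0 : V = 0
    · rw [hV0, degree_zero]
      exact WithBot.bot_lt_coe _
    · rw [degree_eq_natDegree hV0] at hdeg ⊢
      norm_cast at hdeg ⊢
      omega
  have hVcoeff : V.coeff m = 1 - θ ^ 2 := by
    rw [hV, sub_mul, coeff_sub, coeff_X_mul, coeff_C_mul,
      coeff_eq_zero_of_degree_lt hVdeg] at hcoeff
    linarith
  refine exists_splitData (Y := pts lam \ pts lamh) (B := C (1 - θ ^ 2)⁻¹ * V) hlam hlamh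
    h.theta_pos h.cond_common.2 (Finset.disjoint_sdiff.mono_left Finset.inter_subset_right)
    (by rw [Finset.union_comm, Finset.sdiff_union_inter]) hcard ⟨?_, ?_⟩ ?_ ?_ ?_
  · rw [hm, ← smul_eq_C_mul]
    exact (degree_smul_le _ _).trans_lt hVdeg
  · intro y hy
    have hyK : y ≠ K := fun h => hK (h ▸ hy)
    rw [eval_mul, eval_C, mul_assoc]
    refine mul_pos (inv_pos.2 hpos) ?_
    have h1 := interlace_sign_sdiff hlam hlamh h.interlace
      (fun hK1 => by by_contra hK2; exact hK (Finset.mem_sdiff.2 ⟨hK1, hK2⟩)) hy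
    have h2 : (nod (pts lamh \ pts lam)).eval y = (y - K) * V.eval y := by
      have := congrArg (eval y) hV
      simpa [reducedNum, eval_nod_eq_zero.2 hy] using this
    rw [h2] at h1
    have h3 : 0 < (y - K) ^ 2 * (V.eval y * (nod ((pts lam \ pts lamh).erase y)).eval y) := by
      linarith
    exact pos_of_mul_pos_right h3 (sq_nonneg _)
  · rw [hm, Nat.succ_sub_one, coeff_C_mul, hVcoeff, inv_mul_cancel₀ hpos.ne']
  · intro w hw
    have hwY : w ∉ pts lam \ pts lamh := fun h => (Finset.mem_sdiff.1 h).2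
      (Finset.mem_inter.1 hw).2
    rw [eval_mul]
    refine mul_eq_zero_of_right _ ?_
    by_cases hwK : w = K
    · subst hwK
      have hG : (nod (pts lam \ pts lamh)).eval w ≠ 0 := fun h0 => hwY (eval_nod_eq_zero.1 h0)
      have hd : HasDerivAt (Nhat lam lamh) _ w :=
        (((nod (pts lamh \ pts lam)).hasDerivAt w).fun_div
          ((nod (pts lam \ pts lamh)).hasDerivAt w) hG).congr_of_eventuallyEq
          (Filter.Eventually.of_forall fun x => Nhat_eq x)
      have h0 := hd.deriv.symm.trans (hder hw)
      rw [div_eq_zero_iff, or_iff_left (pow_ne_zero 2 hG)] at h0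
      rw [Nhat_eq, div_eq_iff hG] at hNK
      rw [hNK] at h0
      have h1 : (derivative (reducedNum lam lamh θ)).eval w = V.eval w := by
        rw [hV]
        simp
      rw [← h1, reducedNum]
      simp only [derivative_sub, derivative_C_mul, eval_sub, eval_mul, eval_C]
      refine mul_left_cancel₀ hG ?_
      linear_combination h0
    · have h1 := congrArg (eval w) hV
      rw [eval_reducedNum hwY, h.cond_common.1 w (Finset.mem_erase.2 ⟨hwK, hw⟩)] at h1
      simp only [sub_self, zero_mul, eval_mul, eval_sub, eval_X, eval_C] at h1
      exact (mul_eq_zero.1 h1.symm).resolve_left (sub_ne_zero.2 hwK)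
  · have e : C (1 - θ ^ 2) * C (1 - θ ^ 2)⁻¹ = (1 : ℝ[X]) := by
      rw [← C_mul, mul_inv_cancel₀ hpos.ne', C_1]
    rw [nod_pts_eq_reducedNum lam lamh θ, hV]
    linear_combination (-((X - C K) * nod (pts lam ∩ pts lamh) * V)) * e

end JacobiInverse
end

theorem mainTheorem2 {N : ℕ} (n : Fin N) (lam lamh : Fin N → ℝ)
    (hlam : StrictMono lam) (hlamh : StrictMono lamh) (K θ : ℝ)
    (h : SpectralConditions n lam lamh K θ) (q : ℕ) (hq : q = (commonPts lam lamh K).card) :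
    ((K ∉ pts lam ∪ pts lamh ∨ (K ∈ pts lam ∪ pts lamh ∧ CaseA n lam lamh K θ)) →
      IsDisjointUnionOfBalls ((N - 2 * q - 1).choose (n.val - q)) q
          (inverseFamily n lam lamh K θ) ∧
        (q ≠ 0 → (inverseFamily n lam lamh K θ).Infinite) ∧
        (q = 0 → (inverseFamily n lam lamh K θ).Finite ∧
          (inverseFamily n lam lamh K θ).ncard = (N - 1).choose n.val)) ∧
    ((K ∈ pts lam ∪ pts lamh ∧ CaseB n lam lamh K θ) →
      IsDisjointUnionOfBalls ((N - 2 * q - 3).choose (n.val - q - 1)) (q + 1)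
          (inverseFamily n lam lamh K θ) ∧
        (inverseFamily n lam lamh K θ).Infinite) := by
  subst hq
  constructor
  · intro hK
    have hdata : (∃ Z R a, JacobiInverse.SplitData n lam lamh K θ Z (commonPts lam lamh K) R a) ∧
        (commonPts lam lamh K).card ≤ min n.val (N - n.val - 1) := by
      rcases hK with hK | ⟨hK, hA⟩
      · obtain ⟨hcard, hNK⟩ := h.cond_notMem hK
        have hKI : K ∉ pts lam ∩ pts lamh := fun h1 =>
          hK (Finset.mem_union_left _ (Finset.mem_inter.1 h1).1)
        have e : commonPts lam lamh K = pts lam ∩ pts lamh := Finset.erase_eq_of_notMem hKI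
        refine ⟨?_, hcard⟩
        rw [e] at hcard ⊢
        exact JacobiInverse.exists_splitData_of_Nhat_eq hlam hlamh h
          (fun h1 => hK (Finset.mem_union_left _ (Finset.mem_sdiff.1 h1).1)) hNK
          (hcard.trans (min_le_left _ _)) fun h1 => absurd h1 hKI
      · exact ⟨JacobiInverse.exists_splitData_of_caseA hlam hlamh h (h.cond_mem hK).1 hA, hA.1⟩
    obtain ⟨⟨Z, R, a, hdata⟩, hcard⟩ := hdata
    have hU := hdata.isDisjointUnionOfBalls
    refine ⟨hU, fun hq => ?_, fun hq => ?_⟩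
    · refine JacobiInverse.IsDisjointUnionOfBalls.infinite hU (Nat.choose_pos ?_) hq
      have := n.2
      omega
    · rw [hq] at hU
      exact JacobiInverse.IsDisjointUnionOfBalls.finite_ncard hU
  · rintro ⟨hK, hcard, hNK, hder⟩
    have hKI := (h.cond_mem hK).1
    have e : (pts lam ∩ pts lamh).card = (commonPts lam lamh K).card + 1 :=
      (Finset.card_erase_add_one hKI).symm
    obtain ⟨Z, R, a, hdata⟩ := JacobiInverse.exists_splitData_of_Nhat_eq hlam hlamh h
      (fun h1 => (Finset.mem_sdiff.1 h1).2 (Finset.mem_inter.1 hKI).2) hNK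
      (by rw [e]; omega) fun _ => hder
    have hU := hdata.isDisjointUnionOfBalls
    rw [e, show N - 2 * ((commonPts lam lamh K).card + 1) - 1 =
      N - 2 * (commonPts lam lamh K).card - 3 by omega, ← Nat.sub_sub] at hU
    refine ⟨hU, JacobiInverse.IsDisjointUnionOfBalls.infinite hU (Nat.choose_pos ?_)
      (Nat.succ_ne_zero _)⟩
    have := n.2
    omega
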